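/- Let $q$ be a prime power, $\mathbb F=\mathbb F_{q^2}$, and let $R=\mathbb F[x,y]=\mathbb F[X,Y]/(X^{q+1}-Y^q-Y)$ be the coordinate ring of the affine Hermitian curve, with $\mathbb F$-rational points $P_k=(\alpha_k,\beta_k)$, $1\le k\le n=q^3$. Every $f\in R$ is uniquely $f=\sum_{a\ge 0,\,0\le b<q}f_{a,b}x^ay^b$; for $f\ne0$ put $\rho(f)=\max\{aq+b(q+1): f_{a,b}\ne0\}$. Let $'=d/dx$ be the $\mathbb F$-derivation of $R$ with $x'=1$ and $y'=x^q$. Let $z_0^*=y^{q-1}+1$ and $z_b^*=y^{q-1-b}$ for $0<b<q$. Let $e=(e_1,\dots,e_n)\in\mathbb F^n$ be a nonzero vector; $P_k$ is an error position if $e_k\neq0$. Put $s_{a,b}=\sum_{k}e_k\alpha_k^a\beta_k^b$ for integers $a\ge0$, and $s_{a,b}=0$ for $a<0$. Let $I^e=\{f\in R: f(P_k)=0\text{ whenever }e_k\ne0\}$, $\Delta^e=\rho(R\setminus\{0\})\setminus\rho(I^e\setminus\{0\})$, $\sigma_i=\min\{\rho(f):0\ne f\in I^e,\ \rho(f)\equiv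 i \bmod q\}$ for $0\le i<q$, and $$M=\max_i\sigma_i+\max\{\max\Delta^e,\ q^2-q-1\}.$$ Define $f_i^{(m)},\varphi_i^{(m)},g_i^{(m)},\psi_i^{(m)}\in R$ for $0\le i<q$ and $m\ge 0$ recursively. Initially $f_i^{(0)}=y^i$, $\varphi_i^{(0)}=0$, $g_i^{(0)}=0$, $\psi_i^{(0)}=-z_i^*$. Given the data for $m$, for each $0\le i<q$ let $0\le j<q$ be the index with $i+j\equiv m\bmod q$, and put $d_i=\rho(f_i^{(m)})$, $d_j=\rho(f_j^{(m)})$, $r_i=(m-d_i-j(q+1))/q$, $\tilde f_i=y^jf_i^{(m)}$, $\mu_i=\sum_{c=0}^{q-1}\sum_a(\tilde f_i)_{a,c}\,s_{a+r_i,c}$, $p=(d_i+d_j-m)/q-1$ (the divisions by $q$ are exact), and $$\begin{pmatrix}f_i^{(m+1)}&\varphi_i^{(m+1)}\\ g_j^{(m+1)}&\psi_j^{(m+1)}\end{pmatrix}=U_i^{(m)}\begin{pmatrix}f_i^{(m)}&\varphi_i^{(m)}\\ g_j^{(m)}&\psi_j^{(m)}\end{pmatrix},$$ where $U_i^{(m)}=\begin{pmatrix}1&-\mu_ix^p\\0&1\end{pmatrix}$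 if $\mu_i=0$ or $p\ge0$ (the entry $-\mu_ix^p$ being $0$ when $\mu_i=0$), and $U_i^{(m)}=\begin{pmatrix}x^{-p}&-\mu_i\\1/\mu_i&0\end{pmatrix}$ otherwise. Put $f_i=f_i^{(M+1)}$ and $g_i=g_i^{(M+1)}$. Then for every error position $P_k$, $\sum_{i=0}^{q-1}f_i'(P_k)g_i(P_k)\neq 0$ and $$e_k=\Bigl(\sum_{i=0}^{q-1}f_i'(P_k)\,g_i(P_k)\Bigr)^{-1}.$$ -/

import Mathlib

open Polynomial

namespace Hermitian

noncomputable section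

section Curve

variable (K : Type*) [Field K] (q : ℕ)

/-- The polynomial `Y ^ q + Y - X ^ (q + 1)` in `K[X][Y]`; the outer variable is `Y`. -/
def curvePoly : K[X][X] := X ^ q + X - C (X ^ (q + 1))

theorem curvePoly_monic [hq : Fact (IsPrimePow q)] : (curvePoly K q).Monic := by
  have h1 : 1 < q := hq.out.one_lt
  have : curvePoly K q = X ^ q + (X - C (X ^ (q + 1))) := by
    unfold curvePoly; ring
  rw [this]
  refine monic_X_pow_add ?_
  rw [degree_X_sub_C]
  exact_mod_cast h1

/-- The ring `K[x, y] = K[X, Y] / (X ^ (q + 1) - Y ^ q - Y)`. -/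
abbrev CoordRing : Type _ := AdjoinRoot (curvePoly K q)

/-- The class of `X`. -/
def x : CoordRing K q := AdjoinRoot.of (curvePoly K q) X

/-- The class of `Y`. -/
def y : CoordRing K q := AdjoinRoot.root (curvePoly K q)

/-- The affine `K`-rational points `(α, β)` of the curve. -/
abbrev Point : Type _ := {P : K × K // P.1 ^ (q + 1) = P.2 ^ q + P.2}

variable {K q}

/-- Evaluation of a function at a point, `f ↦ f(P)`. -/
def evalAt (P : Point K q) : CoordRing K q →+* K :=
  AdjoinRoot.lift (evalRingHom P.1.1) P.1.2 (by
    rw [curvePoly, eval₂_sub, eval₂_add, eval₂_X_pow, eval₂_X, eval₂_C]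
    simp [P.2])

/-- The polynomials `f_b(x)` of the unique expansion
`f = f_0(x) + f_1(x) y + ⋯ + f_{q-1}(x) y ^ (q-1)`. -/
def component [Fact (IsPrimePow q)] (f : CoordRing K q) (b : ℕ) : K[X] :=
  (AdjoinRoot.modByMonicHom (curvePoly_monic K q) f).coeff b

/-- The order function: the maximum of `a q + b (q + 1)` over the monomials
`x ^ a y ^ b`, `b < q`, that occur in `f`. It is only meaningful for `f ≠ 0`. -/
def rho [Fact (IsPrimePow q)] (f : CoordRing K q) : ℕ :=
  (Finset.univ : Finset (Fin q)).sup fun b =>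
    (component f b).support.sup fun a => a * q + b * (q + 1)

/-- `∂/∂X + X ^ q ∂/∂Y` on `K[X][Y]`. -/
def ambientDerivation (K : Type*) [Field K] (q : ℕ) : Derivation K K[X][X] K[X][X] :=
  PolynomialModule.equivPolynomialSelf.compDer
      (Derivation.mapCoeffs (derivative' : Derivation K K[X] K[X])) +
    (C (X ^ q) : K[X][X]) •
      (derivative' : Derivation K[X] K[X][X] K[X][X]).restrictScalars K

theorem ambientDerivation_C (c : K[X]) :
    ambientDerivation K q (C c) = C (derivative c) := by
  simp [ambientDerivation]

theorem ambientDerivation_X : ambientDerivation K q X = C (X ^ q) := by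
  simp [ambientDerivation]

theorem ambientDerivation_curvePoly [Fintype K] [Fact (IsPrimePow q)]
    (hK : Fintype.card K = q ^ 2) : ambientDerivation K q (curvePoly K q) = 0 := by
  have h0 : (q : K) = 0 := by
    have h := Nat.cast_card_eq_zero K
    rw [hK] at h
    exact pow_eq_zero_iff (two_ne_zero) |>.1 (by exact_mod_cast h)
  have h1 : (q : K[X]) = 0 := by
    rw [← C_eq_natCast, h0, C_0]
  have h2 : (q : K[X][X]) = 0 := by
    rw [← C_eq_natCast, h1, C_0]
  rw [curvePoly, map_sub, map_add, Derivation.leibniz_pow, ambientDerivation_C,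
    ambientDerivation_X, derivative_X_pow]
  simp [h0, h2]

/-- The quotient map `K[X][Y] → K[x, y]` as a homomorphism of `K`-algebras. -/
def quotientMap (K : Type*) [Field K] (q : ℕ) : K[X][X] →ₐ[K] CoordRing K q :=
  (AdjoinRoot.mkₐ (curvePoly K q)).restrictScalars K

theorem mk_ambientDerivation_eq_zero [Fintype K] [Fact (IsPrimePow q)]
    (hK : Fintype.card K = q ^ 2) (p : K[X][X])
    (hp : quotientMap K q p = 0) :
    quotientMap K q (ambientDerivation K q p) = 0 := by
  obtain ⟨a, rfl⟩ := AdjoinRoot.mk_eq_zero.1 hp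
  rw [Derivation.leibniz, ambientDerivation_curvePoly hK, smul_zero, add_zero]
  exact AdjoinRoot.mk_eq_zero.2 (Dvd.intro _ rfl)

/-- `d/dx`: the `K`-derivation of `K[x, y]` with `dx/dx = 1` and `dy/dx = x ^ q`. -/
def ddx [Fintype K] [Fact (IsPrimePow q)] (hK : Fintype.card K = q ^ 2) :
    Derivation K (CoordRing K q) (CoordRing K q) :=
  Derivation.liftOfSurjective (f := quotientMap K q)
    AdjoinRoot.mk_surjective (mk_ambientDerivation_eq_zero hK)

theorem ddx_x [Fintype K] [Fact (IsPrimePow q)] (hK : Fintype.card K = q ^ 2) :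
    ddx hK (x K q) = 1 := by
  have h := Derivation.liftOfSurjective_apply (f := quotientMap K q)
    AdjoinRoot.mk_surjective (mk_ambientDerivation_eq_zero hK) (C X)
  rw [ambientDerivation_C, derivative_X] at h
  exact h.trans (map_one _)

theorem ddx_y [Fintype K] [Fact (IsPrimePow q)] (hK : Fintype.card K = q ^ 2) :
    ddx hK (y K q) = x K q ^ q := by
  have h := Derivation.liftOfSurjective_apply (f := quotientMap K q)
    AdjoinRoot.mk_surjective (mk_ambientDerivation_eq_zero hK) X
  rw [ambientDerivation_X, C_pow, map_pow] at h
  exact h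

end Curve

section ErrorVector

variable {K : Type*} [Field K] {q : ℕ}

/-- The ideal of all functions that vanish at the error positions of `e`. -/
def errorLocatorIdeal (e : Point K q → K) : Ideal (CoordRing K q) where
  carrier := {f | ∀ P, e P ≠ 0 → evalAt P f = 0}
  zero_mem' := fun P _ => map_zero (evalAt P)
  add_mem' := fun {f g} hf hg P hP => by rw [map_add, hf P hP, hg P hP, add_zero]
  smul_mem' := fun c f hf P hP => by rw [smul_eq_mul, map_mul, hf P hP, mul_zero]

/-- `s_{a,b} = ∑_k e_k α_k ^ a β_k ^ b` for `a ≥ 0`, and `s_{a,b} = 0` for `a < 0`. -/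
def syndrome [Fintype K] [DecidableEq K] (e : Point K q → K) (a : ℤ) (b : ℕ) : K :=
  if 0 ≤ a then ∑ P : Point K q, e P * P.1.1 ^ a.toNat * P.1.2 ^ b else 0

variable [Fact (IsPrimePow q)]

/-- The footprint: the orders of nonzero functions that are not orders of
nonzero elements of the error locator ideal. -/
def footprint (e : Point K q → K) : Set ℕ :=
  {d | ∃ f : CoordRing K q, f ≠ 0 ∧ rho f = d} \
    {d | ∃ f ∈ errorLocatorIdeal e, f ≠ 0 ∧ rho f = d}

/-- `σ_i`, the least order congruent to `i` modulo `q` of a nonzero element of the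
error locator ideal. -/
def sigma (e : Point K q → K) (i : Fin q) : ℕ :=
  sInf {d | d ≡ i [MOD q] ∧ ∃ f ∈ errorLocatorIdeal e, f ≠ 0 ∧ rho f = d}

/-- The last iteration `M = max_i σ_i + max {max Δ, q ^ 2 - q - 1}`, with `Δ` the
footprint. -/
def lastIteration (e : Point K q → K) : ℕ :=
  (Finset.univ : Finset (Fin q)).sup (sigma e) + max (sSup (footprint e)) (q ^ 2 - q - 1)

end ErrorVector

section Algorithm

variable (K : Type*) [Field K] (q : ℕ)

/-- The data `f_i, φ_i, g_i, ψ_i`, `0 ≤ i < q`, held by the algorithm. -/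
structure State where
  f : Fin q → CoordRing K q
  φ : Fin q → CoordRing K q
  g : Fin q → CoordRing K q
  ψ : Fin q → CoordRing K q

/-- The `∗`-basis: `y ^ (q-1) + 1` for `b = 0` and `y ^ (q-1-b)` for `0 < b < q`. -/
def zstar (b : Fin q) : CoordRing K q :=
  if (b : ℕ) = 0 then y K q ^ (q - 1) + 1 else y K q ^ (q - 1 - b)

/-- The initial data `f_i = y ^ i`, `φ_i = 0`, `g_i = 0`, `ψ_i = - z_i^∗`. -/
def initialState : State K q where
  f := fun i => y K q ^ (i : ℕ)
  φ := fun _ => 0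
  g := fun _ => 0
  ψ := fun i => -zstar K q i

variable {K q}

/-- The index `j` with `0 ≤ j < q` and `i + j ≡ m` modulo `q`. -/
def partner (m : ℕ) (i : Fin q) : Fin q :=
  ⟨(m + (q - i)) % q, Nat.mod_lt _ i.pos⟩

variable [Fact (IsPrimePow q)]

/-- `r_i = (m - d_i - j (q + 1)) / q`; for the data produced by the algorithm the
division is exact. -/
def shift (m : ℕ) (s : State K q) (i : Fin q) : ℤ :=
  ((m : ℤ) - rho (s.f i) - (partner m i : ℕ) * (q + 1)) / q

/-- `p = (d_i + d_j - m) / q - 1`; for the data produced by the algorithm the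
division is exact. -/
def gap (m : ℕ) (s : State K q) (i : Fin q) : ℤ :=
  ((rho (s.f i) : ℤ) + rho (s.f (partner m i)) - m) / q - 1

variable [Fintype K] [DecidableEq K]

/-- `μ_i = ∑_c ∑_a (y ^ j f_i)_{a,c} s_{a + r_i, c}`. -/
def discrepancy (e : Point K q → K) (m : ℕ) (s : State K q) (i : Fin q) : K :=
  ∑ c : Fin q, (component (y K q ^ (partner m i : ℕ) * s.f i) c).sum
    fun a t => t * syndrome e (a + shift m s i) c

/-- The update matrix `U_i`. -/
def updateMatrix (e : Point K q → K) (m : ℕ) (s : State K q) (i : Fin q) :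
    Matrix (Fin 2) (Fin 2) (CoordRing K q) :=
  let μ := discrepancy e m s i
  let p := gap m s i
  if μ = 0 ∨ 0 ≤ p then
    !![1, -(algebraMap K (CoordRing K q) μ * x K q ^ p.toNat); 0, 1]
  else
    !![x K q ^ (-p).toNat, -algebraMap K (CoordRing K q) μ;
      algebraMap K (CoordRing K q) μ⁻¹, 0]

/-- The product of `U_i` with the matrix with rows `(f_i, φ_i)` and `(g_j, ψ_j)`,
where `i + j ≡ m` modulo `q`. -/
def updatedBlock (e : Point K q → K) (m : ℕ) (s : State K q) (i : Fin q) :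
    Matrix (Fin 2) (Fin 2) (CoordRing K q) :=
  updateMatrix e m s i *
    !![s.f i, s.φ i; s.g (partner m i), s.ψ (partner m i)]

/-- Iteration `m`: the rows of the `i`-th updated block are the new `(f_i, φ_i)` and the
new `(g_j, ψ_j)`. Since `j ↦ i` is again `partner m`, the new `(g_i, ψ_i)` stands in the
second row of the block with index `partner m i`. -/
def step (e : Point K q → K) (m : ℕ) (s : State K q) : State K q where
  f := fun i => updatedBlock e m s i 0 0
  φ := fun i => updatedBlock e m s i 0 1
  g := fun i => updatedBlock e m s (partner m i) 1 0
  ψ := fun i => updatedBlock e m s (partner m i) 1 1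

/-- The data with superscript `(m)`, before iteration `m`. -/
def stateAt (e : Point K q → K) : ℕ → State K q
  | 0 => initialState K q
  | m + 1 => step e m (stateAt e m)

/-- The output of the algorithm, after the iterations `0, …, M`. -/
def finalState (e : Point K q → K) : State K q :=
  stateAt e (lastIteration e + 1)

end Algorithm

end

end Hermitian

namespace Hermitian

noncomputable section

/-! ### Expansion in powers of y, and the trace form. -/

section Components

variable {K : Type*} [Field K] {q : ℕ}

/-! Let Tr f be the coefficient of y^(q-1) in f. It is a K[x]-linear form for which the z_b^* are
dual to the y^b. Put S = ∑_P e_P Z_P / (x - α_P), where Z_P = ∑_b β_P^b z_b^* is `pointStar P`. The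
syndromes are the coefficients of S at x = ∞, and `residual e r (f, φ)` is the coefficient of
x^(-r-1) in Tr(f S - φ).

The algorithm is of Berlekamp–Massey type. By `Invariant`, f_i S agrees with φ_i to an order that
grows with m, while g_i S - ψ_i has a known first term, normalised to 1, used to cancel the next
discrepancy. The pairs (f_i, φ_i) are isotropic for Tr(f ψ - φ g). Hence the discrepancies of an
index and of its partner agree (`Invariant.discrepancy_partner`), and both are updated by one matrix
of determinant 1. This preserves the symplectic relations and, before taking traces, the identity ∑
(f_i ψ_i - φ_i g_i) = -1 (`sum_det_update`).

Throughout, ρ(f_i) ≤ σ_i (`Invariant.wt_le_sigma`). So after iteration M every f_i lies in the error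
locator ideal (`Invariant.f_mem`), and f_i S = φ_i holds exactly (`residual_finalState`). Clearing
denominators with x^(q^2) - x and differentiating at an error position P gives φ_i(P) = e_P f_i'(P)
(`evalAt_eq_mul_ddx`). At P, where f_i vanishes, the determinant identity becomes e_P ∑ f_i'(P)
g_i(P) = 1. -/

theorem smul_eq_C_smul (u : K) (f : CoordRing K q) : u • f = (C u : K[X]) • f := by
  rw [← algebraMap_eq, algebraMap_smul]

theorem x_mul (f : CoordRing K q) : x K q * f = (X : K[X]) • f := by
  rw [Algebra.smul_def]; rfl

theorem x_pow_mul (n : ℕ) (f : CoordRing K q) :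
    x K q ^ n * f = (X ^ n : K[X]) • f := by
  rw [Algebra.smul_def, map_pow]; rfl

theorem y_pow_q : y K q ^ q = x K q ^ (q + 1) - y K q := by
  have h : AdjoinRoot.mk (curvePoly K q) (curvePoly K q) = 0 := AdjoinRoot.mk_self
  have h2 : AdjoinRoot.mk (curvePoly K q) (curvePoly K q) =
      y K q ^ q + y K q - x K q ^ (q + 1) := by
    conv_lhs => enter [2]; unfold curvePoly
    rw [map_sub, map_add, map_pow, C_pow, map_pow]
    rfl
  rw [h2] at h
  linear_combination h

variable [Fact (IsPrimePow q)]

theorem one_lt_q : 1 < q := (Fact.out : IsPrimePow q).one_lt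

theorem natDegree_curvePoly : (curvePoly K q).natDegree = q := by
  have : curvePoly K q = X ^ q + (X - C (X ^ (q + 1))) := by
    unfold curvePoly; ring
  rw [this, natDegree_add_eq_left_of_natDegree_lt, natDegree_X_pow]
  rw [natDegree_X_sub_C, natDegree_X_pow]
  exact one_lt_q

/-- The `b`-th component as a linear map over `K[X]`. -/
def componentHom (b : ℕ) : CoordRing K q →ₗ[K[X]] K[X] :=
  (lcoeff K[X] b).comp (AdjoinRoot.modByMonicHom (curvePoly_monic K q))

theorem componentHom_apply (f : CoordRing K q) (b : ℕ) :
    componentHom b f = component f b := rfl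

theorem component_sub (f g : CoordRing K q) (b : ℕ) :
    component (f - g) b = component f b - component g b :=
  map_sub (componentHom b) f g

theorem component_smul (p : K[X]) (f : CoordRing K q) (b : ℕ) :
    component (p • f) b = p * component f b :=
  map_smul (componentHom b) p f

theorem component_smul' (u : K) (f : CoordRing K q) (b : ℕ) :
    component (u • f) b = u • component f b := by
  rw [smul_eq_C_smul, component_smul, smul_eq_C_mul]

theorem component_zero (b : ℕ) : component (0 : CoordRing K q) b = 0 :=
  map_zero (componentHom b)

theorem component_y_pow {c : ℕ} (hc : c < q) (b : ℕ) :
    component (y K q ^ c) b = if b = c then 1 else 0 := by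
  have h : y K q ^ c = AdjoinRoot.mk (curvePoly K q) (X ^ c) := by
    rw [map_pow]; rfl
  rw [component, h, AdjoinRoot.modByMonicHom_mk,
    (modByMonic_eq_self_iff (curvePoly_monic K q)).2, coeff_X_pow]
  rw [degree_X_pow, degree_eq_natDegree (curvePoly_monic K q).ne_zero, natDegree_curvePoly]
  exact_mod_cast hc

theorem eq_sum_component (f : CoordRing K q) :
    f = ∑ c : Fin q, component f c • y K q ^ (c : ℕ) := by
  have h := AdjoinRoot.mk_leftInverse (curvePoly_monic K q) f
  have hd : (AdjoinRoot.modByMonicHom (curvePoly_monic K q) f).natDegree < q := by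
    obtain ⟨p, rfl⟩ := AdjoinRoot.mk_surjective f
    rw [AdjoinRoot.modByMonicHom_mk]
    have := natDegree_modByMonic_lt p (curvePoly_monic K q) (by
      intro h1
      have := natDegree_curvePoly (K := K) (q := q)
      rw [h1, natDegree_one] at this
      have := one_lt_q (q := q)
      omega)
    rwa [natDegree_curvePoly] at this
  conv_lhs => rw [← h, as_sum_range' _ q hd, map_sum]
  rw [Finset.sum_range]
  refine Finset.sum_congr rfl fun c _ => ?_
  rw [← C_mul_X_pow_eq_monomial, map_mul, map_pow, Algebra.smul_def]
  rfl

theorem ext_component {f g : CoordRing K q}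
    (h : ∀ c : Fin q, component f c = component g c) : f = g := by
  rw [eq_sum_component f, eq_sum_component g]
  exact Finset.sum_congr rfl fun c _ => by rw [h]

/-- Two `K[X]`-linear maps agree if they agree on `1, y, …, y ^ (q-1)`. -/
theorem hom_ext {V : Type*} [AddCommGroup V] [Module K[X] V]
    {A B : CoordRing K q →ₗ[K[X]] V}
    (h : ∀ c : Fin q, A (y K q ^ (c : ℕ)) = B (y K q ^ (c : ℕ))) : A = B := by
  ext1 f
  rw [eq_sum_component f, map_sum, map_sum]
  exact Finset.sum_congr rfl fun c _ => by rw [map_smul, map_smul, h]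

/-- The trace form: the top component. -/
def trace : CoordRing K q →ₗ[K[X]] K[X] := componentHom (q - 1)

theorem trace_y_pow {c : ℕ} (hc : c < q) :
    trace (y K q ^ c) = if c = q - 1 then 1 else 0 := by
  rw [trace, componentHom_apply, component_y_pow hc]
  simp only [eq_comm]

/-- Duality of the two bases. Reducing by y^q = x^(q+1) - y gives Tr(y^(2q-2)) = -1, and the summand
1 in z_0^* cancels exactly this term. -/
theorem trace_y_pow_mul_zstar (b c : Fin q) :
    trace (y K q ^ (b : ℕ) * zstar K q c) = if b = c then 1 else 0 := by
  have hq := one_lt_q (q := q)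
  have hb := b.2
  have hc := c.2
  have key : ∀ n, n < q - 1 → trace (y K q ^ (q + n)) = if n + 2 = q then -1 else 0 := by
    intro n hn
    have : y K q ^ (q + n) =
        (X ^ (q + 1) : K[X]) • y K q ^ n - y K q ^ (n + 1) := by
      rw [← x_pow_mul, pow_add, y_pow_q]; ring
    rw [this, map_sub, map_smul, trace_y_pow (by omega), trace_y_pow (by omega)]
    rw [if_neg (by omega)]
    by_cases h : n + 2 = q
    · rw [if_pos (by omega), if_pos h]; simp
    · rw [if_neg (by omega), if_neg h]; simp
  rw [zstar]
  simp only [Fin.ext_iff]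
  split_ifs with h0 h1 h1
  · rw [mul_add, mul_one, ← pow_add, map_add, trace_y_pow (c := b) hb, h1, h0,
      trace_y_pow (by omega)]
    rw [if_pos (by omega), if_neg (by omega), add_zero]
  · rw [mul_add, mul_one, ← pow_add, map_add, trace_y_pow (c := b) hb,
      show (b : ℕ) + (q - 1) = q + (b - 1) by omega, key _ (by omega)]
    by_cases h : (b : ℕ) = q - 1
    · rw [if_pos h, if_pos (by omega)]; simp
    · rw [if_neg h, if_neg (by omega)]; simp
  · rw [← pow_add, trace_y_pow (by omega), if_pos (by omega)]
  · rw [← pow_add]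
    by_cases h : (b : ℕ) + (q - 1 - c) < q
    · rw [trace_y_pow h, if_neg (by omega)]
    · rw [show (b : ℕ) + (q - 1 - c) = q + (b - 1 - c) by omega, key _ (by omega),
        if_neg (by omega)]

theorem trace_mul_zstar (f : CoordRing K q) (c : Fin q) :
    trace (f * zstar K q c) = component f c := by
  have : (trace (K := K) (q := q)).comp (LinearMap.mulRight K[X] (zstar K q c)) =
      componentHom (c : ℕ) := by
    refine hom_ext fun b => ?_
    rw [LinearMap.comp_apply, LinearMap.mulRight_apply, trace_y_pow_mul_zstar,
      componentHom_apply, component_y_pow b.2]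
    simp only [Fin.ext_iff, eq_comm]
  exact LinearMap.congr_fun this f

/-- Nondegeneracy of the trace form: the components of f are its traces against the dual basis. -/
theorem eq_zero_of_trace {f : CoordRing K q}
    (h : ∀ c : Fin q, trace (y K q ^ (c : ℕ) * f) = 0) : f = 0 := by
  have h0 : (trace (K := K) (q := q)).comp (LinearMap.mulRight K[X] f) = 0 :=
    hom_ext fun c => h c
  refine ext_component fun c => ?_
  rw [← trace_mul_zstar, mul_comm, component_zero]
  exact LinearMap.congr_fun h0 (zstar K q c)

end Components

/-! ### Coefficients of Laurent series in 1/x. -/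

section Pairing

variable {K : Type*} [Field K]

/-- The coefficient functional `∑ p_a X ^ a ↦ ∑ p_a s_{a + r}`. -/
def seqPair (s : ℤ → K) (r : ℤ) : K[X] →ₗ[K] K :=
  Polynomial.lsum fun a => s (a + r) • LinearMap.id

theorem seqPair_apply (s : ℤ → K) (r : ℤ) (p : K[X]) :
    seqPair s r p = p.sum fun a t => t * s (a + r) := by
  simp [seqPair, Polynomial.lsum_apply, mul_comm]

theorem seqPair_monomial (s : ℤ → K) (r : ℤ) (a : ℕ) (t : K) :
    seqPair s r (monomial a t) = t * s (a + r) := by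
  rw [seqPair_apply, sum_monomial_index _ _ (by simp)]

theorem seqPair_X_mul (s : ℤ → K) (r : ℤ) (p : K[X]) :
    seqPair s r (X * p) = seqPair s (r + 1) p := by
  induction p using Polynomial.induction_on' with
  | add p₁ p₂ h₁ h₂ => rw [mul_add, map_add, map_add, h₁, h₂]
  | monomial n a =>
    rw [X_mul_monomial, seqPair_monomial, seqPair_monomial]
    congr 2; push_cast; ring

/-- The sequence with generating series `1 / (x - α)`. -/
def geom (α : K) (n : ℤ) : K := if 0 ≤ n then α ^ n.toNat else 0

/-- The sequence concentrated in `-1`. -/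
def deltaSeq (K : Type*) [Field K] (n : ℤ) : K := if n = -1 then 1 else 0

theorem geom_succ (α : K) (n : ℤ) : geom α (n + 1) = α * geom α n + deltaSeq K n := by
  unfold geom deltaSeq
  rcases lt_trichotomy n (-1) with h | h | h
  · rw [if_neg (by omega), if_neg (by omega), if_neg (by omega)]; simp
  · subst h; simp
  · rw [if_pos (by omega), if_pos (by omega), if_neg (by omega),
      show (n + 1).toNat = n.toNat + 1 by omega, pow_succ]; ring

theorem seqPair_deltaSeq (r : ℤ) (p : K[X]) :
    seqPair (deltaSeq K) r p = if r < 0 then p.coeff (-r - 1).toNat else 0 := by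
  induction p using Polynomial.induction_on' with
  | add p₁ p₂ h₁ h₂ => rw [map_add, h₁, h₂]; split_ifs <;> simp
  | monomial n a =>
    rw [seqPair_monomial, coeff_monomial, deltaSeq]
    split_ifs <;> first | omega | simp

/-- The identity (x - α) · 1/(x - α) = 1, read coefficientwise; `deltaSeq` is the series 1. -/
theorem seqPair_geom (α : K) (r : ℤ) (p : K[X]) :
    seqPair (geom α) r ((X - C α) * p) = seqPair (deltaSeq K) r p := by
  induction p using Polynomial.induction_on' with
  | add p₁ p₂ h₁ h₂ => rw [mul_add, map_add, map_add, h₁, h₂]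
  | monomial n a =>
    rw [sub_mul, map_sub, seqPair_X_mul, C_mul_monomial, seqPair_monomial, seqPair_monomial,
      seqPair_monomial, ← add_assoc, geom_succ]
    ring

theorem seqPair_geom_nonneg (α : K) {r : ℤ} (hr : 0 ≤ r) (p : K[X]) :
    seqPair (geom α) r p = α ^ r.toNat * p.eval α := by
  induction p using Polynomial.induction_on' with
  | add p₁ p₂ h₁ h₂ => rw [map_add, h₁, h₂, eval_add, mul_add]
  | monomial n a =>
    rw [seqPair_monomial, eval_monomial, geom, if_pos (by omega),
      show ((n : ℤ) + r).toNat = n + r.toNat by omega, pow_add]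
    ring

end Pairing

/-! ### Orders of monomials with possibly negative exponent of x. -/

section Weight

/-- The order `r q + c (q + 1)` of the monomial `x ^ r y ^ c`, `r` possibly negative. -/
def wt (q : ℕ) (r : ℤ) (c : ℕ) : ℤ := r * q + c * (q + 1)

theorem wt_add (q : ℕ) (r n : ℤ) (c : ℕ) : wt q (r + n) c = wt q r c + n * q := by
  unfold wt; ring

/-- The order is congruent to c modulo q, which determines c and then r. -/
theorem wt_inj {q : ℕ} {r r' : ℤ} {c c' : Fin q} (h : wt q r c = wt q r' c') :
    r = r' ∧ c = c' := by
  have hq : (0 : ℤ) < q := by exact_mod_cast c.pos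
  unfold wt at h
  have h1 : ((c : ℕ) : ℤ) = ((c' : ℕ) : ℤ) := by
    have h2 : (((c : ℕ) : ℤ) + (r + (c : ℕ)) * q) % q =
        (((c' : ℕ) : ℤ) + (r' + (c' : ℕ)) * q) % q := by
      congr 1; linarith
    rwa [Int.add_mul_emod_self_right, Int.add_mul_emod_self_right,
      Int.emod_eq_of_lt (by positivity) (by exact_mod_cast c.2),
      Int.emod_eq_of_lt (by positivity) (by exact_mod_cast c'.2)] at h2
  refine ⟨?_, Fin.ext (by exact_mod_cast h1)⟩
  rw [h1] at h
  exact mul_right_cancel₀ hq.ne' (add_right_cancel h)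

theorem wt_lt_iff {q : ℕ} {r r' : ℤ} {c : Fin q} : wt q r c < wt q r' c ↔ r < r' := by
  have hq : (0 : ℤ) < q := by exact_mod_cast c.pos
  unfold wt
  rw [add_lt_add_iff_right, mul_lt_mul_iff_left₀ hq]

end Weight

/-! ### Leading monomials. -/

section Lead

variable {K : Type*} [Field K] {q : ℕ} [Fact (IsPrimePow q)]

/-- The monomial `x ^ k y ^ i` occurs in `f` with coefficient `1` and has the largest order
among the monomials of `f`. -/
structure HasLead (f : CoordRing K q) (k : ℕ) (i : Fin q) : Prop where
  coeff_eq : (component f i).coeff k = 1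
  le : ∀ (a : ℕ) (c : Fin q), (component f c).coeff a ≠ 0 → wt q a c ≤ wt q k i

theorem HasLead.lt {f : CoordRing K q} {k : ℕ} {i : Fin q} (h : HasLead f k i) {a : ℕ}
    {c : Fin q} (hne : ¬(a = k ∧ c = i)) (hc : (component f c).coeff a ≠ 0) :
    wt q a c < wt q k i :=
  lt_of_le_of_ne (h.le a c hc) fun he => hne (by
    obtain ⟨h1, h2⟩ := wt_inj he
    exact ⟨by exact_mod_cast h1, h2⟩)

theorem HasLead.ne_zero {f : CoordRing K q} {k : ℕ} {i : Fin q} (h : HasLead f k i) :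
    f ≠ 0 := by
  rintro rfl
  have := h.coeff_eq
  rw [component_zero, coeff_zero] at this
  exact zero_ne_one this

theorem le_rho {f : CoordRing K q} {a : ℕ} {c : Fin q} (h : (component f c).coeff a ≠ 0) :
    wt q a c ≤ rho f := by
  have h1 : a * q + c * (q + 1) ≤ rho f :=
    (Finset.le_sup (f := fun a => a * q + (c : ℕ) * (q + 1)) (mem_support_iff.2 h)).trans
      (Finset.le_sup (f := fun b : Fin q =>
        (component f b).support.sup fun a => a * q + b * (q + 1)) (Finset.mem_univ c))
  unfold wt
  exact_mod_cast h1

theorem rho_le {f : CoordRing K q} {n : ℕ}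
    (h : ∀ (a : ℕ) (c : Fin q), (component f c).coeff a ≠ 0 → wt q a c ≤ n) : rho f ≤ n := by
  refine Finset.sup_le fun c _ => Finset.sup_le fun a ha => ?_
  have := h a c (mem_support_iff.1 ha)
  unfold wt at this
  exact_mod_cast this

theorem HasLead.rho_eq {f : CoordRing K q} {k : ℕ} {i : Fin q} (h : HasLead f k i) :
    (rho f : ℤ) = wt q k i := by
  refine le_antisymm ?_ (le_rho (by rw [h.coeff_eq]; exact one_ne_zero))
  have := rho_le (f := f) (n := k * q + i * (q + 1)) fun a c hc => by
    have := h.le a c hc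
    unfold wt at this ⊢
    push_cast
    exact this
  unfold wt
  exact_mod_cast this

theorem exists_coeff_of_ne_zero {f : CoordRing K q} (hf : f ≠ 0) :
    ∃ (a : ℕ) (c : Fin q), (component f c).coeff a ≠ 0 ∧ (rho f : ℤ) = wt q a c := by
  by_contra! hcon
  have hex : ∃ (a : ℕ) (c : Fin q), (component f c).coeff a ≠ 0 := by
    by_contra! h
    exact hf (ext_component fun c => by ext a; rw [h, component_zero, coeff_zero])
  obtain ⟨a, c, hac⟩ := hex
  -- Positivity is needed because the bound `rho f - 1` below is a truncated subtraction.
  have hpos : 0 < rho f := by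
    have h1 := le_rho hac
    have h2 := hcon a c hac
    have h3 : 0 ≤ wt q a c := by unfold wt; positivity
    omega
  have := rho_le (f := f) (n := rho f - 1) fun a c hc => by
    have h1 := le_rho hc
    have h2 := hcon a c hc
    omega
  omega

theorem exists_hasLead {f : CoordRing K q} (hf : f ≠ 0) :
    ∃ (u : K) (k : ℕ) (i : Fin q), u ≠ 0 ∧ HasLead (u • f) k i ∧ (rho f : ℤ) = wt q k i := by
  obtain ⟨a, c, hac, hr⟩ := exists_coeff_of_ne_zero hf
  refine ⟨((component f c).coeff a)⁻¹, a, c, inv_ne_zero hac, ⟨?_, fun a' c' h => ?_⟩, hr⟩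
  · rw [component_smul', coeff_smul, smul_eq_mul, inv_mul_cancel₀ hac]
  · rw [← hr]
    refine le_rho fun h0 => h ?_
    rw [component_smul', coeff_smul, h0, smul_zero]

theorem rho_sub_lt {f g : CoordRing K q} {k : ℕ} {i : Fin q} (hf : HasLead f k i)
    (hg : HasLead g k i) (hne : f - g ≠ 0) : rho (f - g) < rho f := by
  obtain ⟨a, c, hac, hr⟩ := exists_coeff_of_ne_zero hne
  rw [component_sub, coeff_sub] at hac
  have hlead : ¬(a = k ∧ c = i) := by
    rintro ⟨rfl, rfl⟩
    rw [hf.coeff_eq, hg.coeff_eq, sub_self] at hac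
    exact hac rfl
  have h : wt q a c < wt q k i := by
    by_cases h0 : (component f c).coeff a = 0
    · exact hg.lt hlead fun h1 => hac (by rw [h0, h1, sub_zero])
    · exact hf.lt hlead h0
  rw [← hr, ← hf.rho_eq] at h
  exact_mod_cast h

theorem hasLead_y_pow (i : Fin q) : HasLead (y K q ^ (i : ℕ)) 0 i := by
  refine ⟨by rw [component_y_pow i.2, if_pos rfl, coeff_one_zero], fun a c h => ?_⟩
  rw [component_y_pow i.2] at h
  split_ifs at h with h1
  · rw [coeff_one] at h
    split_ifs at h with h2
    · subst h2; rw [h1]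
    · exact absurd rfl h
  · exact absurd (coeff_zero a) h

theorem coeff_component_x_pow_mul (n a : ℕ) (c : ℕ) (f : CoordRing K q) :
    (component (x K q ^ n * f) c).coeff a =
      if n ≤ a then (component f c).coeff (a - n) else 0 := by
  rw [x_pow_mul, component_smul, coeff_X_pow_mul']

theorem HasLead.x_pow_mul {f : CoordRing K q} {k : ℕ} {i : Fin q} (h : HasLead f k i)
    (n : ℕ) : HasLead (x K q ^ n * f) (k + n) i := by
  refine ⟨?_, fun a c hc => ?_⟩
  · rw [coeff_component_x_pow_mul, if_pos (by omega), Nat.add_sub_cancel, h.coeff_eq]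
  · rw [coeff_component_x_pow_mul] at hc
    split_ifs at hc with h1
    · have := h.le _ _ hc
      rw [Nat.cast_sub h1, sub_eq_add_neg, wt_add] at this
      push_cast
      rw [wt_add]
      linarith
    · exact absurd rfl hc

/-- Subtracting terms of smaller order does not change the leading monomial. -/
theorem HasLead.sub {f g : CoordRing K q} {k : ℕ} {i : Fin q} (h : HasLead f k i)
    (hg : ∀ (a : ℕ) (c : Fin q), (component g c).coeff a ≠ 0 → wt q a c < wt q k i) :
    HasLead (f - g) k i := by
  refine ⟨?_, fun a c hc => ?_⟩
  · rw [component_sub, coeff_sub, h.coeff_eq, sub_eq_self]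
    by_contra h0
    exact lt_irrefl _ (hg k i h0)
  · rw [component_sub, coeff_sub] at hc
    by_cases h0 : (component f c).coeff a = 0
    · exact (hg a c fun h1 => hc (by rw [h0, h1, sub_zero])).le
    · exact h.le a c h0

end Lead

/-! ### The syndrome series and residuals. -/

section Functionals

variable {K : Type*} [Field K] {q : ℕ}

theorem evalAt_smul (P : Point K q) (p : K[X]) (f : CoordRing K q) :
    evalAt P (p • f) = p.eval P.1.1 * evalAt P f := by
  rw [Algebra.smul_def, map_mul]
  congr 1
  exact AdjoinRoot.lift_of _

theorem evalAt_x (P : Point K q) : evalAt P (x K q) = P.1.1 := by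
  rw [x, evalAt, AdjoinRoot.lift_of]; simp

theorem evalAt_y (P : Point K q) : evalAt P (y K q) = P.1.2 := by
  rw [y, evalAt, AdjoinRoot.lift_root]

variable [Fact (IsPrimePow q)]

theorem evalAt_eq_sum (P : Point K q) (f : CoordRing K q) :
    evalAt P f = ∑ c : Fin q, P.1.2 ^ (c : ℕ) * (component f c).eval P.1.1 := by
  conv_lhs => rw [eq_sum_component f, map_sum]
  refine Finset.sum_congr rfl fun c _ => ?_
  rw [evalAt_smul, map_pow, evalAt_y, mul_comm]

/-- The coefficient of `x ^ (-r-1)` in the trace of `φ`. -/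
def polarPart (r : ℤ) : CoordRing K q →ₗ[K] K :=
  (seqPair (deltaSeq K) r).comp (trace.restrictScalars K)

theorem polarPart_apply (r : ℤ) (φ : CoordRing K q) :
    polarPart r φ = seqPair (deltaSeq K) r (trace φ) := rfl

theorem polarPart_x_mul (r : ℤ) (φ : CoordRing K q) :
    polarPart r (x K q * φ) = polarPart (r + 1) φ := by
  rw [polarPart_apply, x_mul, map_smul, smul_eq_mul, seqPair_X_mul, polarPart_apply]

theorem polarPart_x_pow_mul (n : ℕ) (r : ℤ) (φ : CoordRing K q) :
    polarPart r (x K q ^ n * φ) = polarPart (r + n) φ := by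
  induction n generalizing r with
  | zero => simp
  | succ n ih =>
    rw [pow_succ', mul_assoc, polarPart_x_mul, ih]
    rw [show r + ((n + 1 : ℕ) : ℤ) = r + 1 + n by push_cast; ring]

/-- The trace of φ is a polynomial, so it has no negative powers of x. -/
theorem polarPart_nonneg {r : ℤ} (hr : 0 ≤ r) (φ : CoordRing K q) : polarPart r φ = 0 := by
  rw [polarPart_apply, seqPair_deltaSeq, if_neg (by omega)]

theorem polarPart_y_pow_mul_zstar (r : ℤ) (b c : Fin q) :
    polarPart r (y K q ^ (b : ℕ) * zstar K q c) = if r = -1 ∧ b = c then 1 else 0 := by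
  rw [polarPart_apply, trace_y_pow_mul_zstar, seqPair_deltaSeq]
  by_cases h : b = c
  · rw [if_pos h, coeff_one]
    split_ifs <;> first | rfl | omega
  · rw [if_neg h, coeff_zero, ite_self, if_neg (fun h1 => h h1.2)]

theorem eq_of_polarPart {φ ψ : CoordRing K q}
    (h : ∀ (r : ℤ) (c : Fin q),
      polarPart r (y K q ^ (c : ℕ) * φ) = polarPart r (y K q ^ (c : ℕ) * ψ)) : φ = ψ := by
  rw [← sub_eq_zero]
  refine eq_zero_of_trace fun c => ?_
  ext n
  have := h (-n - 1) c
  rw [← sub_eq_zero, ← map_sub, ← mul_sub, polarPart_apply, seqPair_deltaSeq,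
    if_pos (by omega), show (-(-(n : ℤ) - 1) - 1).toNat = n by omega] at this
  rw [this, coeff_zero]

variable [Fintype K] [DecidableEq K]

/-- `f ↦ ∑ f_{a,c} s_{a + r, c}`. -/
def syndromePart (e : Point K q → K) (r : ℤ) : CoordRing K q →ₗ[K] K :=
  ∑ c : Fin q, (seqPair (fun a => syndrome e a c) r).comp
    ((componentHom (c : ℕ)).restrictScalars K)

theorem syndromePart_apply (e : Point K q → K) (r : ℤ) (f : CoordRing K q) :
    syndromePart e r f =
      ∑ c : Fin q, seqPair (fun a => syndrome e a c) r (component f c) := by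
  rw [syndromePart, LinearMap.sum_apply]; rfl

theorem discrepancy_eq (e : Point K q → K) (m : ℕ) (s : State K q) (i : Fin q) :
    discrepancy e m s i =
      syndromePart e (shift m s i) (y K q ^ (partner m i : ℕ) * s.f i) := by
  rw [syndromePart_apply, discrepancy]
  exact Finset.sum_congr rfl fun c _ => (seqPair_apply (fun a => syndrome e a c) _ _).symm

theorem syndromePart_x_mul (e : Point K q → K) (r : ℤ) (f : CoordRing K q) :
    syndromePart e r (x K q * f) = syndromePart e (r + 1) f := by
  rw [syndromePart_apply, syndromePart_apply]
  refine Finset.sum_congr rfl fun c _ => ?_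
  rw [x_mul, component_smul, seqPair_X_mul]

/-- The contribution of the point `P` to `syndromePart`. -/
def pointPart (P : Point K q) (r : ℤ) (f : CoordRing K q) : K :=
  ∑ c : Fin q, P.1.2 ^ (c : ℕ) * seqPair (geom P.1.1) r (component f c)

theorem syndromePart_eq_sum (e : Point K q → K) (r : ℤ) (f : CoordRing K q) :
    syndromePart e r f = ∑ P, e P * pointPart P r f := by
  rw [syndromePart_apply]
  simp only [pointPart, Finset.mul_sum]
  rw [Finset.sum_comm]
  refine Finset.sum_congr rfl fun c _ => ?_
  simp only [seqPair_apply, Polynomial.sum, Finset.mul_sum]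
  rw [Finset.sum_comm]
  refine Finset.sum_congr rfl fun a _ => ?_
  unfold syndrome geom
  split_ifs
  · rw [Finset.mul_sum]
    exact Finset.sum_congr rfl fun P _ => by ring
  · simp

/-- For r ≥ 0 the convention s_{a,b} = 0 for a < 0 never intervenes, so the pairing is evaluation of
x^r f. -/
theorem syndromePart_nonneg (e : Point K q → K) {r : ℤ} (hr : 0 ≤ r) (f : CoordRing K q) :
    syndromePart e r f = ∑ P, e P * (P.1.1 ^ r.toNat * evalAt P f) := by
  rw [syndromePart_eq_sum]
  refine Finset.sum_congr rfl fun P _ => ?_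
  rw [pointPart, evalAt_eq_sum, Finset.mul_sum (a := P.1.1 ^ r.toNat)]
  refine congrArg (e P * ·) (Finset.sum_congr rfl fun c _ => ?_)
  rw [seqPair_geom_nonneg _ hr]
  ring

theorem syndromePart_neg (e : Point K q → K) {r : ℤ} (hr : r < 0) {c : ℕ} (hc : c < q) :
    syndromePart e r (y K q ^ c) = 0 := by
  rw [syndromePart_apply]
  refine Finset.sum_eq_zero fun b _ => ?_
  rw [component_y_pow hc]
  split_ifs
  · rw [← C_1, ← monomial_zero_left, seqPair_monomial, syndrome, if_neg (by simpa using hr),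
      mul_zero]
  · rw [map_zero]

theorem syndromePart_x_pow_mul (e : Point K q → K) (n : ℕ) (r : ℤ) (f : CoordRing K q) :
    syndromePart e r (x K q ^ n * f) = syndromePart e (r + n) f := by
  induction n generalizing r with
  | zero => simp
  | succ n ih =>
    rw [pow_succ', mul_assoc, syndromePart_x_mul, ih]
    rw [show r + ((n + 1 : ℕ) : ℤ) = r + 1 + n by push_cast; ring]

/-- Supplies the initial residuals, where n = i + c ≤ 2q - 2. This bound makes a single reduction by
the curve equation enough, and reduction never raises the order. -/
theorem syndromePart_of_wt_neg (e : Point K q → K) {r : ℤ} {n : ℕ} (hn : n < 2 * q - 1)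
    (h : wt q r n < 0) : syndromePart e r (y K q ^ n) = 0 := by
  have hneg : ∀ (r : ℤ) (c : ℕ), wt q r c < 0 → r < 0 := fun r c h => by
    by_contra! h0
    have : 0 ≤ wt q r c := by unfold wt; positivity
    omega
  by_cases hnq : n < q
  · exact syndromePart_neg e (hneg r n h) hnq
  · obtain ⟨b, rfl⟩ := Nat.exists_eq_add_of_le (not_lt.1 hnq)
    have h1 : y K q ^ (q + b) = x K q ^ (q + 1) * y K q ^ b - y K q ^ (b + 1) := by
      rw [pow_add, y_pow_q]; ring
    rw [h1, map_sub, syndromePart_x_pow_mul, syndromePart_neg e _ (by omega),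
      syndromePart_neg e (hneg r _ h) (by omega), sub_zero]
    refine hneg _ b ?_
    rw [wt_add]
    unfold wt at h ⊢
    push_cast at h ⊢
    linarith

/-- For a pair `(f, φ)`, the coefficient of `x ^ (-r-1)` in the trace of `f S - φ`, where `S`
is the syndrome series. -/
def residual (e : Point K q → K) (r : ℤ) : CoordRing K q × CoordRing K q →ₗ[K] K :=
  (syndromePart e r).comp (LinearMap.fst K _ _) - (polarPart r).comp (LinearMap.snd K _ _)

theorem residual_apply (e : Point K q → K) (r : ℤ) (v : CoordRing K q × CoordRing K q) :
    residual e r v = syndromePart e r v.1 - polarPart r v.2 := rfl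

theorem residual_x_smul (e : Point K q → K) (r : ℤ) (v : CoordRing K q × CoordRing K q) :
    residual e r (x K q • v) = residual e (r + 1) v := by
  rw [residual_apply, residual_apply, Prod.smul_fst, Prod.smul_snd, smul_eq_mul, smul_eq_mul,
    syndromePart_x_mul, polarPart_x_mul]

theorem residual_x_pow_smul (e : Point K q → K) (n : ℕ) (r : ℤ)
    (v : CoordRing K q × CoordRing K q) :
    residual e r (x K q ^ n • v) = residual e (r + n) v := by
  induction n generalizing r with
  | zero => simp
  | succ n ih =>
    rw [pow_succ', mul_smul, residual_x_smul, ih]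
    rw [show r + ((n + 1 : ℕ) : ℤ) = r + 1 + n by push_cast; ring]

theorem residual_polynomial_smul (e : Point K q → K) (r : ℤ) (p : K[X]) (u : CoordRing K q)
    (v : CoordRing K q × CoordRing K q) :
    residual e r ((p • u) • v) = p.sum fun a t => t * residual e (r + a) (u • v) := by
  induction p using Polynomial.induction_on' with
  | add p₁ p₂ h₁ h₂ =>
    rw [add_smul, add_smul, map_add, h₁, h₂, sum_add_index]
    · simp
    · intros; ring
  | monomial n a =>
    rw [sum_monomial_index _ _ (by simp), ← C_mul_X_pow_eq_monomial, mul_smul,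
      ← smul_eq_C_smul, ← x_pow_mul, smul_assoc, map_smul, smul_eq_mul, mul_smul,
      residual_x_pow_smul]

theorem residual_smul (e : Point K q → K) (r : ℤ) (f : CoordRing K q)
    (v : CoordRing K q × CoordRing K q) :
    residual e r (f • v) = ∑ c : Fin q, (component f c).sum
      fun a t => t * residual e (r + a) (y K q ^ (c : ℕ) • v) := by
  conv_lhs => rw [eq_sum_component f, Finset.sum_smul, map_sum]
  exact Finset.sum_congr rfl fun c _ => residual_polynomial_smul _ _ _ _ _

/-- If the residual of `v` vanishes below the leading monomial of `f`, then only the leading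
monomial contributes to the residual of `f v`. -/
theorem HasLead.residual_smul {f : CoordRing K q} {k : ℕ} {i : Fin q} (h : HasLead f k i)
    (e : Point K q → K) (r : ℤ) (v : CoordRing K q × CoordRing K q)
    (hz : ∀ (a : ℕ) (c : Fin q), wt q a c < wt q k i →
      residual e (r + a) (y K q ^ (c : ℕ) • v) = 0) :
    residual e r (f • v) = residual e (r + k) (y K q ^ (i : ℕ) • v) := by
  rw [Hermitian.residual_smul, Finset.sum_eq_single i]
  · rw [Polynomial.sum, Finset.sum_eq_single k]
    · rw [h.coeff_eq, one_mul]
    · intro a ha hak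
      rw [hz a i (h.lt (fun h1 => hak h1.1) (mem_support_iff.1 ha)), mul_zero]
    · intro hk
      rw [mem_support_iff, h.coeff_eq] at hk
      exact absurd one_ne_zero hk
  · intro c _ hci
    refine Finset.sum_eq_zero fun a ha => ?_
    beta_reduce
    rw [hz a c (h.lt (fun h1 => hci h1.2) (mem_support_iff.1 ha)), mul_zero]
  · intro hi
    exact absurd (Finset.mem_univ i) hi

end Functionals

/-! ### The pairing of indices in one iteration. -/

section Partner

theorem exists_eq_add_partner {q : ℕ} (m : ℕ) (i : Fin q) :
    ∃ n : ℤ, (m : ℤ) = (i : ℕ) + (partner m i : ℕ) + q * n := by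
  refine ⟨((m + (q - i)) / q : ℕ) - 1, ?_⟩
  have h := Nat.mod_add_div (m + (q - i)) q
  have hi := i.2
  have h2 : ((partner m i : ℕ) : ℤ) + q * ((m + (q - i)) / q : ℕ) = m + (q - (i : ℕ)) := by
    rw [← Nat.cast_sub hi.le]
    exact_mod_cast h
  linarith

theorem partner_partner {q : ℕ} (m : ℕ) (i : Fin q) : partner m (partner m i) = i := by
  obtain ⟨n, hn⟩ := exists_eq_add_partner m i
  obtain ⟨n', hn'⟩ := exists_eq_add_partner m (partner m i)
  refine (wt_inj (q := q) (r := n' - (partner m (partner m i) : ℕ)) (r' := n - (i : ℕ)) ?_).2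
  unfold wt
  linarith

end Partner

/-! ### Symplectic relations and the determinant identity. -/

section Symplectic

variable {K : Type*} [Field K] {q : ℕ} {v w : Fin q → CoordRing K q × CoordRing K q}
  {a b c d : Fin q → K[X]} {σ : Fin q → Fin q}

/-- The involution σ carries the same matrix at i and σ i. Terms in two v's or two w's cancel after
reindexing by σ, and the rest is multiplied by ad - bc = 1. No trace is taken, so the identity can
be evaluated at points. -/
theorem sum_det_update (hσ : ∀ i, σ (σ i) = i)
    (ha : ∀ i, a (σ i) = a i) (hb : ∀ i, b (σ i) = b i) (hc : ∀ i, c (σ i) = c i)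
    (hd : ∀ i, d (σ i) = d i) (hdet : ∀ i, a i * d i - b i * c i = 1) :
    ∑ i, ((a i • v i + b i • w (σ i)).1 * (c i • v (σ i) + d i • w i).2 -
      (a i • v i + b i • w (σ i)).2 * (c i • v (σ i) + d i • w i).1) =
    ∑ i, ((v i).1 * (w i).2 - (v i).2 * (w i).1) := by
  have hsum : ∀ F : Fin q → CoordRing K q, ∑ i, F (σ i) = ∑ i, F i := fun F =>
    Equiv.sum_comp (⟨σ, σ, hσ, hσ⟩ : Fin q ≃ Fin q) F
  have h1 := hsum fun i => (a i * c i) • ((v i).2 * (v (σ i)).1)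
  have h2 := hsum fun i => (b i * c i) • ((v i).1 * (w i).2 - (v i).2 * (w i).1)
  have h3 := hsum fun i => (b i * d i) • ((w i).1 * (w (σ i)).2)
  simp only [hσ, ha, hb, hc, hd] at h1 h2 h3
  have h4 : ∀ i, (a i * d i) • ((v i).1 * (w i).2 - (v i).2 * (w i).1) =
      ((v i).1 * (w i).2 - (v i).2 * (w i).1) +
        (b i * c i) • ((v i).1 * (w i).2 - (v i).2 * (w i).1) := fun i => by
    rw [← sub_eq_iff_eq_add, ← sub_smul, hdet, one_smul]
  have h5 : ∀ i, (a i • v i + b i • w (σ i)).1 * (c i • v (σ i) + d i • w i).2 -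
      (a i • v i + b i • w (σ i)).2 * (c i • v (σ i) + d i • w i).1 =
      ((a i * c i) • ((v (σ i)).2 * (v i).1) - (a i * c i) • ((v i).2 * (v (σ i)).1)) +
      ((b i * d i) • ((w (σ i)).1 * (w i).2) - (b i * d i) • ((w i).1 * (w (σ i)).2)) +
      (a i * d i) • ((v i).1 * (w i).2 - (v i).2 * (w i).1) -
      (b i * c i) • ((v (σ i)).1 * (w (σ i)).2 - (v (σ i)).2 * (w (σ i)).1) := fun i => by
    simp only [Prod.fst_add, Prod.snd_add, Prod.smul_fst, Prod.smul_snd]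
    simp only [Algebra.smul_def, map_mul]
    ring
  rw [Finset.sum_congr rfl fun i _ => h5 i, Finset.sum_sub_distrib, Finset.sum_add_distrib,
    Finset.sum_congr rfl fun i _ => h4 i, Finset.sum_add_distrib, Finset.sum_add_distrib,
    Finset.sum_sub_distrib, Finset.sum_sub_distrib, h1, h2, h3]
  ring

variable [Fact (IsPrimePow q)]

/-- The alternating form `((f, φ), (g, ψ)) ↦ Tr (f ψ - φ g)`. -/
def symp (u v : CoordRing K q × CoordRing K q) : K[X] := trace (u.1 * v.2 - u.2 * v.1)

theorem symp_swap (u v : CoordRing K q × CoordRing K q) : symp v u = -symp u v := by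
  rw [symp, symp, ← map_neg]
  congr 1; ring

theorem symp_combination (a b c d : K[X]) (u v u' v' : CoordRing K q × CoordRing K q) :
    symp (a • u + b • v) (c • u' + d • v') =
      a * c * symp u u' + a * d * symp u v' + b * c * symp v u' + b * d * symp v v' := by
  have h : (a • u + b • v).1 * (c • u' + d • v').2 - (a • u + b • v).2 * (c • u' + d • v').1 =
      (a * c) • (u.1 * u'.2 - u.2 * u'.1) + (a * d) • (u.1 * v'.2 - u.2 * v'.1) +
        (b * c) • (v.1 * u'.2 - v.2 * u'.1) + (b * d) • (v.1 * v'.2 - v.2 * v'.1) := by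
    simp only [Prod.fst_add, Prod.snd_add, Prod.smul_fst, Prod.smul_snd]
    simp only [Algebra.smul_def, map_mul]
    ring
  simp only [symp, h, map_add, map_smul, smul_eq_mul]

/-- The pairs `v_i`, `w_i` form a symplectic basis, up to sign. -/
structure IsSymplectic (v w : Fin q → CoordRing K q × CoordRing K q) : Prop where
  vv : ∀ i k, symp (v i) (v k) = 0
  ww : ∀ i k, symp (w i) (w k) = 0
  vw : ∀ i k, symp (v i) (w k) = if i = k then -1 else 0

theorem IsSymplectic.wv (h : IsSymplectic v w) (i k : Fin q) :
    symp (w i) (v k) = if i = k then 1 else 0 := by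
  rw [symp_swap, h.vw]
  by_cases hik : i = k
  · rw [if_pos hik, if_pos hik.symm, neg_neg]
  · rw [if_neg hik, if_neg (Ne.symm hik), neg_zero]

/-- Only the pairs k = i and k = σ i interact; equality of the matrices at i and σ i cancels the
first two kinds of product, and determinant 1 preserves the third. -/
theorem IsSymplectic.update (h : IsSymplectic v w) (hσ : ∀ i, σ (σ i) = i)
    (ha : ∀ i, a (σ i) = a i) (hb : ∀ i, b (σ i) = b i) (hc : ∀ i, c (σ i) = c i)
    (hd : ∀ i, d (σ i) = d i) (hdet : ∀ i, a i * d i - b i * c i = 1) :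
    IsSymplectic (fun i => a i • v i + b i • w (σ i))
      (fun i => c i • v (σ i) + d i • w i) := by
  refine ⟨fun i k => ?_, fun i k => ?_, fun i k => ?_⟩
  · rw [symp_combination, h.vv, h.vw, h.wv, h.ww]
    by_cases hik : σ i = k
    · subst hik
      rw [hσ, if_pos rfl, if_pos rfl, ha, hb]; ring
    · rw [if_neg hik, if_neg (fun h1 => hik (by rw [h1, hσ]))]; ring
  · rw [symp_combination, h.vv, h.vw, h.wv, h.ww]
    by_cases hik : σ i = k
    · subst hik
      rw [hσ, if_pos rfl, if_pos rfl, hc, hd]; ring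
    · rw [if_neg hik, if_neg (fun h1 => hik (by rw [h1, hσ]))]; ring
  · rw [symp_combination, h.vv, h.vw, h.wv, h.ww]
    by_cases hik : i = k
    · subst hik
      rw [if_pos rfl, if_pos rfl]
      linear_combination -hdet i
    · rw [if_neg hik, if_neg (fun h1 => hik (by rw [← hσ i, h1, hσ]))]; ring

end Symplectic

/-! ### The loop invariant and its initial case. -/

section Invariant

variable {K : Type*} [Field K] {q : ℕ}

theorem natCast_q_eq_zero [Fintype K] (hK : Fintype.card K = q ^ 2) : (q : K) = 0 := by
  have h := Nat.cast_card_eq_zero K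
  rw [hK] at h
  exact pow_eq_zero_iff two_ne_zero |>.1 (by exact_mod_cast h)

/-- Stated over any commutative ring so as to serve both for y itself and for the values of
`pointStar`. -/
theorem sum_mul_zstar [Fact (IsPrimePow q)] {A : Type*} [CommRing A] (Z : Fin q → A) (b Y : A)
    (hZ : ∀ c : Fin q, Z c = if (c : ℕ) = 0 then Y ^ (q - 1) + 1 else Y ^ (q - 1 - c)) :
    ∑ c : Fin q, b ^ (c : ℕ) * Z c =
      ∑ c ∈ Finset.range q, b ^ c * Y ^ (q - 1 - c) + 1 := by
  have hq := one_lt_q (q := q)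
  have h1 : ∀ c : Fin q, b ^ (c : ℕ) * Z c =
      b ^ (c : ℕ) * Y ^ (q - 1 - c) + if (c : ℕ) = 0 then 1 else 0 := fun c => by
    rw [hZ]
    split_ifs with h
    · rw [h]; simp
    · simp
  simp only [h1, Finset.sum_add_distrib]
  rw [Fin.sum_univ_eq_sum_range (fun c => b ^ c * Y ^ (q - 1 - c)),
    Fin.sum_univ_eq_sum_range (fun c => if c = 0 then (1 : A) else 0)]
  simp [show q ≠ 0 by omega]

/-- The sum is q y^(q-1) + 1, and q = 0 in K. -/
theorem sum_y_pow_mul_zstar [Fact (IsPrimePow q)] [Fintype K] (hK : Fintype.card K = q ^ 2) :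
    ∑ c : Fin q, y K q ^ (c : ℕ) * zstar K q c = 1 := by
  rw [sum_mul_zstar (fun c => zstar K q c) _ (y K q) (fun c => rfl)]
  have h1 : ∀ c ∈ Finset.range q, y K q ^ c * y K q ^ (q - 1 - c) = y K q ^ (q - 1) :=
    fun c hc => by
      rw [← pow_add]; congr 1; have := Finset.mem_range.1 hc; omega
  rw [Finset.sum_congr rfl h1, Finset.sum_const, Finset.card_range, ← Nat.cast_smul_eq_nsmul K,
    natCast_q_eq_zero hK, zero_smul, zero_add]

/-- The pair `(f_i, φ_i)`. -/
def State.fPair (s : State K q) (i : Fin q) : CoordRing K q × CoordRing K q := (s.f i, s.φ i)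

/-- The pair `(g_i, ψ_i)`. -/
def State.gPair (s : State K q) (i : Fin q) : CoordRing K q × CoordRing K q := (s.g i, s.ψ i)

variable [Fact (IsPrimePow q)] [Fintype K] [DecidableEq K]

/-- What holds before iteration `m`, with `x ^ (k i) y ^ i` the leading monomial of `f_i`. -/
structure Invariant (e : Point K q → K) (m : ℕ) (s : State K q) (k : Fin q → ℕ) : Prop where
  lead : ∀ i, HasLead (s.f i) (k i) i
  f_residual : ∀ i r (c : Fin q), wt q r c < m - wt q (k i) i →
    residual e r (y K q ^ (c : ℕ) • s.fPair i) = 0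
  -- This lets the discrepancy be computed from f_i and the syndromes alone, without φ_i.
  φ_polar : ∀ i r (c : Fin q), m - wt q (k i) i ≤ wt q r c →
    polarPart r (y K q ^ (c : ℕ) * s.φ i) = 0
  g_residual : ∀ i r (c : Fin q), wt q r c < wt q (k i - 1) i →
    residual e r (y K q ^ (c : ℕ) • s.gPair i) = 0
  g_residual_lead : ∀ i, residual e (k i - 1) (y K q ^ (i : ℕ) • s.gPair i) = 1
  ψ_polar : ∀ i r (c : Fin q), wt q (k i - 1) i < wt q r c →
    polarPart r (y K q ^ (c : ℕ) * s.ψ i) = 0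
  -- This ensures that adding multiples of g does not disturb the leading monomial of f.
  g_coeff : ∀ i (a : ℕ) (c : Fin q), (component (s.g i) c).coeff a ≠ 0 →
    wt q a c < m - wt q (k i - 1) i
  symplectic : IsSymplectic s.fPair s.gPair
  sum_det : ∑ i, ((s.fPair i).1 * (s.gPair i).2 - (s.fPair i).2 * (s.gPair i).1) = -1

theorem invariant_initial (hK : Fintype.card K = q ^ 2) (e : Point K q → K) :
    Invariant e 0 (initialState K q) fun _ => 0 := by
  have hg : ∀ r (c i : Fin q),
      residual e r (y K q ^ (c : ℕ) • (initialState K q).gPair i) =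
        if r = -1 ∧ c = i then 1 else 0 := fun r c i => by
    rw [residual_apply]
    simp [State.gPair, initialState, polarPart_y_pow_mul_zstar]
  constructor
  · exact fun i => hasLead_y_pow i
  · intro i r c h
    rw [residual_apply, Prod.smul_fst, Prod.smul_snd]
    simp only [State.fPair, initialState, smul_eq_mul, mul_zero, map_zero, sub_zero]
    rw [← pow_add]
    refine syndromePart_of_wt_neg e (by omega) ?_
    unfold wt at h ⊢
    push_cast at h ⊢
    linarith
  · intro i r c _
    simp [initialState]
  · intro i r c h
    rw [hg, if_neg]
    rintro ⟨rfl, rfl⟩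
    simp at h
  · intro i
    rw [hg]; simp
  · intro i r c h
    simp only [initialState, mul_neg, map_neg, polarPart_y_pow_mul_zstar]
    rw [if_neg, neg_zero]
    rintro ⟨rfl, rfl⟩
    simp at h
  · intro i a c h
    simp [initialState, component_zero] at h
  · refine ⟨fun i k => ?_, fun i k => ?_, fun i k => ?_⟩
    · simp [symp, State.fPair, initialState]
    · simp [symp, State.gPair, initialState]
    · simp only [symp, State.fPair, State.gPair, initialState, mul_zero, sub_zero, mul_neg,
        map_neg, trace_y_pow_mul_zstar]
      split_ifs <;> simp
  · simp [State.fPair, State.gPair, initialState, sum_y_pow_mul_zstar hK]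

end Invariant

/-! ### Preservation of the invariant. -/

section Step

theorem wt_sub (q : ℕ) (r n : ℤ) (c : ℕ) : wt q (r - n) c = wt q r c - n * q := by
  rw [sub_eq_add_neg, wt_add]; ring

variable {K : Type*} [Field K] {q : ℕ} [Fact (IsPrimePow q)]

theorem polarPart_polynomial_term (r : ℤ) (u : K) (n : ℕ) (z φ : CoordRing K q) :
    polarPart r (z * ((C u * X ^ n : K[X]) • φ)) = u * polarPart (r + n) (z * φ) := by
  rw [mul_smul_comm, mul_smul, ← smul_eq_C_smul, map_smul, smul_eq_mul, ← x_pow_mul,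
    polarPart_x_pow_mul]

theorem coeff_component_polynomial_term (u : K) (n a c : ℕ) (f : CoordRing K q)
    (h : (component ((C u * X ^ n : K[X]) • f) c).coeff a ≠ 0) :
    u ≠ 0 ∧ n ≤ a ∧ (component f c).coeff (a - n) ≠ 0 := by
  rw [mul_smul, ← x_pow_mul, ← smul_eq_C_smul, component_smul', coeff_smul,
    coeff_component_x_pow_mul] at h
  refine ⟨?_, ?_⟩
  · rintro rfl
    exact h (zero_smul _ _)
  · split_ifs at h with h1
    · exact ⟨h1, fun h0 => h (by rw [h0, smul_zero])⟩
    · exact absurd (smul_zero _) h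

theorem gap_partner (m : ℕ) (s : State K q) (i : Fin q) :
    gap m s (partner m i) = gap m s i := by
  rw [gap, gap, partner_partner, add_comm (rho _ : ℤ)]

variable [Fintype K] [DecidableEq K]
  {e : Point K q → K} {m : ℕ} {s : State K q} {k : Fin q → ℕ}

/-- The update matrix with entries in `K[X]`. -/
def updatePoly (e : Point K q → K) (m : ℕ) (s : State K q) (i : Fin q) :
    Matrix (Fin 2) (Fin 2) K[X] :=
  if discrepancy e m s i = 0 ∨ 0 ≤ gap m s i then
    !![1, -(C (discrepancy e m s i) * X ^ (gap m s i).toNat); 0, 1]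
  else
    !![X ^ (-gap m s i).toNat, -C (discrepancy e m s i); C (discrepancy e m s i)⁻¹, 0]

theorem updateMatrix_apply (e : Point K q → K) (m : ℕ) (s : State K q) (i : Fin q)
    (a b : Fin 2) :
    updateMatrix e m s i a b = algebraMap K[X] (CoordRing K q) (updatePoly e m s i a b) := by
  have hx : ∀ n : ℕ, algebraMap K[X] (CoordRing K q) (X ^ n) = x K q ^ n := fun n => by
    rw [map_pow]; rfl
  have hC : ∀ u : K, algebraMap K (CoordRing K q) u = AdjoinRoot.of (curvePoly K q) (C u) :=
    fun u => rfl
  unfold updateMatrix updatePoly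
  split_ifs <;> fin_cases a <;> fin_cases b <;> simp [hC, ← hx]

theorem det_updatePoly (e : Point K q → K) (m : ℕ) (s : State K q) (i : Fin q) :
    updatePoly e m s i 0 0 * updatePoly e m s i 1 1 -
      updatePoly e m s i 0 1 * updatePoly e m s i 1 0 = 1 := by
  unfold updatePoly
  split_ifs with h
  · simp
  · have : C (discrepancy e m s i) * C (discrepancy e m s i)⁻¹ = (1 : K[X]) := by
      rw [← C_mul, mul_inv_cancel₀ (fun h0 => h (Or.inl h0)), C_1]
    simp [this]

theorem fPair_step (e : Point K q → K) (m : ℕ) (s : State K q) (i : Fin q) :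
    (step e m s).fPair i = updatePoly e m s i 0 0 • s.fPair i +
      updatePoly e m s i 0 1 • s.gPair (partner m i) := by
  simp only [State.fPair, State.gPair, step, updatedBlock, Matrix.mul_apply, Fin.sum_univ_two,
    updateMatrix_apply, Algebra.smul_def]
  rfl

theorem gPair_step (e : Point K q → K) (m : ℕ) (s : State K q) (i : Fin q) :
    (step e m s).gPair i = updatePoly e m s (partner m i) 1 0 • s.fPair (partner m i) +
      updatePoly e m s (partner m i) 1 1 • s.gPair i := by
  simp only [State.fPair, State.gPair, step, updatedBlock, Matrix.mul_apply, Fin.sum_univ_two,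
    updateMatrix_apply, Algebra.smul_def, partner_partner]
  rfl

/-- With j the partner, x^(r_i) y^j is the monomial of order m - ρ(f_i), the first at which the
residual of (f_i, φ_i) may be nonzero. Exactness of the division is also settled here. -/
theorem Invariant.wt_shift (h : Invariant e m s k) (i : Fin q) :
    wt q (shift m s i) (partner m i) = m - wt q (k i) i := by
  obtain ⟨n, hn⟩ := exists_eq_add_partner m i
  have hq : (q : ℤ) ≠ 0 := by have := one_lt_q (q := q); omega
  have h1 : (m : ℤ) - rho (s.f i) - (partner m i : ℕ) * (q + 1) =
      q * (n - k i - (i : ℕ) - (partner m i : ℕ)) := by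
    rw [(h.lead i).rho_eq, wt]
    linear_combination hn
  rw [shift, h1, Int.mul_ediv_cancel_left _ hq]
  unfold wt
  linear_combination -hn

/-- Multiplication by x^p thus moves the first residual of g_j, at exponent k_j - 1, to the exponent
r_i of the discrepancy. -/
theorem Invariant.gap_eq (h : Invariant e m s k) (i : Fin q) :
    gap m s i = k (partner m i) - 1 - shift m s i := by
  have hq : (q : ℤ) ≠ 0 := by have := one_lt_q (q := q); omega
  have h1 : (rho (s.f i) : ℤ) + rho (s.f (partner m i)) - m =
      q * (k (partner m i) - shift m s i) := by
    have := h.wt_shift i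
    rw [(h.lead i).rho_eq, (h.lead _).rho_eq]
    unfold wt at this ⊢
    linear_combination this
  rw [gap, h1, Int.mul_ediv_cancel_left _ hq]
  ring

theorem Invariant.discrepancy_eq_residual (h : Invariant e m s k) (i : Fin q) :
    discrepancy e m s i =
      residual e (shift m s i) (y K q ^ (partner m i : ℕ) • s.fPair i) := by
  rw [discrepancy_eq, residual_apply]
  simp only [State.fPair, Prod.smul_fst, Prod.smul_snd, smul_eq_mul]
  rw [h.φ_polar i _ _ (h.wt_shift i).ge, sub_zero]

/-- Replacing y^j by f_j adds only terms of vanishing residual, and makes the expression symmetric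
in i and j up to the φ-part. -/
theorem Invariant.discrepancy_eq_residual_f (h : Invariant e m s k) (i : Fin q) :
    discrepancy e m s i =
      residual e (-gap m s i - 1) (s.f (partner m i) • s.fPair i) := by
  have hs : shift m s i = -gap m s i - 1 + k (partner m i) := by rw [h.gap_eq]; ring
  rw [(h.lead (partner m i)).residual_smul, h.discrepancy_eq_residual, hs]
  intro a c hac
  refine h.f_residual i _ c ?_
  rw [← h.wt_shift, hs]
  unfold wt at hac ⊢
  linarith

/-- The product f_i f_j is symmetric, and Tr(f_i φ_j - φ_i f_j) = 0 by isotropy. -/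
theorem Invariant.discrepancy_partner (h : Invariant e m s k) (i : Fin q) :
    discrepancy e m s (partner m i) = discrepancy e m s i := by
  rw [h.discrepancy_eq_residual_f, h.discrepancy_eq_residual_f, partner_partner, gap_partner,
    residual_apply, residual_apply]
  simp only [State.fPair, Prod.smul_fst, Prod.smul_snd, smul_eq_mul]
  have h1 := h.symplectic.vv i (partner m i)
  simp only [symp, State.fPair] at h1
  rw [mul_comm (s.f i) (s.f _), sub_right_inj, ← sub_eq_zero, ← map_sub, polarPart_apply,
    mul_comm (s.f (partner m i)), h1, map_zero]

theorem Invariant.updatePoly_partner (h : Invariant e m s k) (i : Fin q) :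
    updatePoly e m s (partner m i) = updatePoly e m s i := by
  rw [updatePoly, updatePoly, h.discrepancy_partner, gap_partner]

theorem residual_polynomial_term (e : Point K q → K) (r : ℤ) (u : K) (n : ℕ)
    (z : CoordRing K q) (v : CoordRing K q × CoordRing K q) :
    residual e r (z • ((C u * X ^ n : K[X]) • v)) = u * residual e (r + n) (z • v) := by
  have : z • ((C u * X ^ n : K[X]) • v) = ((C u * X ^ n : K[X]) • z) • v := by
    rw [smul_comm, smul_assoc]
  rw [this, residual_polynomial_smul, C_mul_X_pow_eq_monomial,
    sum_monomial_index _ _ (by simp)]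

theorem Invariant.eq_of_wt_eq (h : Invariant e m s k) {i : Fin q} {r : ℤ} {c : Fin q}
    (hw : wt q r c = m - wt q (k i) i) : r = shift m s i ∧ c = partner m i :=
  wt_inj (hw.trans (h.wt_shift i).symm)

/-- The exponents of the leading monomials after iteration `m`. -/
def nextExponent (e : Point K q → K) (m : ℕ) (s : State K q) (k : Fin q → ℕ) (i : Fin q) : ℕ :=
  if discrepancy e m s i = 0 ∨ 0 ≤ gap m s i then k i else k i + (-gap m s i).toNat

/-- The part of the invariant that concerns the index `i` alone. -/
structure LocalInvariant (e : Point K q → K) (m : ℕ) (v w : CoordRing K q × CoordRing K q)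
    (k : ℕ) (i : Fin q) : Prop where
  lead : HasLead v.1 k i
  f_residual : ∀ r (c : Fin q), wt q r c < m - wt q k i →
    residual e r (y K q ^ (c : ℕ) • v) = 0
  φ_polar : ∀ r (c : Fin q), m - wt q k i ≤ wt q r c →
    polarPart r (y K q ^ (c : ℕ) * v.2) = 0
  g_residual : ∀ r (c : Fin q), wt q r c < wt q (k - 1) i →
    residual e r (y K q ^ (c : ℕ) • w) = 0
  g_residual_lead : residual e (k - 1) (y K q ^ (i : ℕ) • w) = 1
  ψ_polar : ∀ r (c : Fin q), wt q (k - 1) i < wt q r c →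
    polarPart r (y K q ^ (c : ℕ) * w.2) = 0
  g_coeff : ∀ (a : ℕ) (c : Fin q), (component w.1 c).coeff a ≠ 0 →
    wt q a c < m - wt q (k - 1) i

theorem Invariant.step_regular (h : Invariant e m s k) {i : Fin q}
    (hc : discrepancy e m s i = 0 ∨ 0 ≤ gap m s i) :
    LocalInvariant e (m + 1) ((step e m s).fPair i) ((step e m s).gPair i) (k i) i := by
  have hf : (step e m s).fPair i = s.fPair i -
      (C (discrepancy e m s i) * X ^ (gap m s i).toNat : K[X]) • s.gPair (partner m i) := by
    rw [fPair_step, updatePoly, if_pos hc]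
    simp [sub_eq_add_neg]
  have hg : (step e m s).gPair i = s.gPair i := by
    rw [gPair_step, h.updatePoly_partner, updatePoly, if_pos hc]
    simp
  have hsh := h.wt_shift i
  have hgap := h.gap_eq i
  -- If μ ≠ 0 then p ≥ 0 and `toNat` is faithful; if μ = 0 its value is irrelevant, as the term is
  -- multiplied by μ.
  have key : discrepancy e m s i ≠ 0 → ∀ r : ℤ, r + ((gap m s i).toNat : ℤ) =
      r + (k (partner m i) - 1) - shift m s i := fun h0 r => by
    have := hc.resolve_left h0; omega
  rw [hf, hg]
  constructor
  · refine (h.lead i).sub fun a c hac => ?_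
    obtain ⟨h0, hle, hco⟩ := coeff_component_polynomial_term _ _ _ _ _ hac
    have h1 := h.g_coeff _ _ _ hco
    have h2 := key h0 0
    rw [Nat.cast_sub hle, wt_sub] at h1
    unfold wt at h1 hsh ⊢
    rw [zero_add, zero_add] at h2
    rw [h2] at h1
    linarith
  · intro r c hw
    rw [smul_sub, map_sub, residual_polynomial_term, sub_eq_zero]
    rcases lt_or_eq_of_le (show wt q r c ≤ m - wt q (k i) i by push_cast at hw; omega)
      with hlt | heq
    · rw [h.f_residual i r c hlt]
      by_cases h0 : discrepancy e m s i = 0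
      · rw [h0, zero_mul]
      · rw [key h0, h.g_residual, mul_zero]
        unfold wt at hlt hsh ⊢
        linarith
    -- Only one monomial has this order; there the residuals are μ and μ · 1.
    · obtain ⟨rfl, rfl⟩ := h.eq_of_wt_eq heq
      rw [← h.discrepancy_eq_residual]
      by_cases h0 : discrepancy e m s i = 0
      · rw [h0, zero_mul]
      · rw [key h0, add_sub_cancel_left, h.g_residual_lead, mul_one]
  · intro r c hw
    rw [Prod.snd_sub, mul_sub, map_sub, Prod.smul_snd, polarPart_polynomial_term]
    rw [State.fPair, State.gPair, h.φ_polar i r c (by push_cast at hw; omega), zero_sub,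
      neg_eq_zero]
    by_cases h0 : discrepancy e m s i = 0
    · rw [h0, zero_mul]
    · rw [key h0, h.ψ_polar, mul_zero]
      push_cast at hw
      unfold wt at hw hsh ⊢
      linarith
  · exact h.g_residual i
  · exact h.g_residual_lead i
  · exact h.ψ_polar i
  · intro a c hac
    have := h.g_coeff i a c hac
    push_cast
    linarith

theorem Invariant.step_jump (h : Invariant e m s k) {i : Fin q}
    (hc : ¬(discrepancy e m s i = 0 ∨ 0 ≤ gap m s i)) :
    LocalInvariant e (m + 1) ((step e m s).fPair i) ((step e m s).gPair i)
      (k i + (-gap m s i).toNat) i := by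
  obtain ⟨hμ, hp⟩ := not_or.1 hc
  obtain ⟨n, hn⟩ : ∃ n : ℕ, (-gap m s i).toNat = n := ⟨_, rfl⟩
  have hn' : gap m s i = -n := by omega
  have hf : (step e m s).fPair i = (C 1 * X ^ n : K[X]) • s.fPair i -
      (C (discrepancy e m s i) * X ^ 0 : K[X]) • s.gPair (partner m i) := by
    rw [fPair_step, updatePoly, if_neg hc, hn]
    simp [sub_eq_add_neg]
  have hg : (step e m s).gPair i =
      (C (discrepancy e m s i)⁻¹ * X ^ 0 : K[X]) • s.fPair (partner m i) := by
    rw [gPair_step, h.updatePoly_partner, updatePoly, if_neg hc]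
    simp
  have hsh := h.wt_shift i
  have hgap := h.gap_eq i
  have hsh' := h.wt_shift (partner m i)
  have hgap' := h.gap_eq (partner m i)
  rw [gap_partner] at hgap'
  have hdis := h.discrepancy_eq_residual (partner m i)
  rw [partner_partner] at hsh' hgap' hdis
  rw [h.discrepancy_partner] at hdis
  -- The new g_i is μ^(-1) times the old f_j, whose first residual sits at its own shift; this must
  -- be the new k_i minus 1.
  have hk : ((k i + n : ℕ) : ℤ) - 1 = shift m s (partner m i) := by push_cast; omega
  have hn2 : (n : ℤ) = shift m s i - (k (partner m i) - 1) := by omega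
  -- The new f_i is known to agree with φ_i up to and including the order at which the old g_j had
  -- its first residual.
  have hw1 : ((m + 1 : ℕ) : ℤ) - wt q (k i + n : ℕ) i =
      wt q (k (partner m i) - 1) (partner m i) + 1 := by
    push_cast
    rw [wt_add, hn2]
    unfold wt at hsh ⊢
    linarith
  rw [hf, hg, hn]
  constructor
  · refine HasLead.sub (f := _) ?_ fun a c hac => ?_
    · have := (h.lead i).x_pow_mul n
      rw [x_pow_mul] at this
      simpa [State.fPair] using this
    · obtain ⟨h0, hle, hco⟩ := coeff_component_polynomial_term _ _ _ _ _ hac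
      have h1 := h.g_coeff _ _ _ hco
      push_cast at hw1
      rw [Nat.sub_zero] at h1
      push_cast
      linarith
  · intro r c hw
    rw [hw1] at hw
    have hle : wt q (r + n) c ≤ m - wt q (k i) i := by
      rw [wt_add, hn2]
      unfold wt at hw hsh ⊢
      linarith
    rw [smul_sub, map_sub, residual_polynomial_term, residual_polynomial_term, sub_eq_zero,
      one_mul, Nat.cast_zero, add_zero]
    rcases lt_or_eq_of_le hle with hlt | heq
    · rw [h.f_residual i _ c hlt, h.g_residual, mul_zero]
      rw [wt_add, hn2] at hlt
      unfold wt at hlt hsh ⊢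
      linarith
    · obtain ⟨hr, rfl⟩ := h.eq_of_wt_eq heq
      rw [hr, ← h.discrepancy_eq_residual, show r = k (partner m i) - 1 by omega,
        h.g_residual_lead, mul_one]
  · intro r c hw
    rw [hw1] at hw
    rw [Prod.snd_sub, mul_sub, map_sub, Prod.smul_snd, Prod.smul_snd,
      polarPart_polynomial_term, polarPart_polynomial_term, Nat.cast_zero, add_zero]
    rw [State.fPair, State.gPair, h.φ_polar, h.ψ_polar, mul_zero, mul_zero, sub_zero]
    · linarith
    · rw [wt_add, hn2]
      unfold wt at hw hsh ⊢
      linarith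
  · intro r c hw
    rw [residual_polynomial_term, Nat.cast_zero, add_zero, h.f_residual, mul_zero]
    rwa [hk, hsh'] at hw
  · rw [residual_polynomial_term, Nat.cast_zero, add_zero, hk, ← hdis, inv_mul_cancel₀ hμ]
  · intro r c hw
    rw [Prod.smul_snd, polarPart_polynomial_term, Nat.cast_zero, add_zero, State.fPair,
      h.φ_polar, mul_zero]
    rw [hk, hsh'] at hw
    exact hw.le
  · intro a c hac
    obtain ⟨-, -, hco⟩ := coeff_component_polynomial_term _ _ _ _ _ hac
    rw [hk, hsh']
    have := (h.lead (partner m i)).le a c (by simpa [State.fPair] using hco)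
    push_cast
    linarith

theorem Invariant.step (h : Invariant e m s k) :
    Invariant e (m + 1) (step e m s) (nextExponent e m s k) := by
  have hloc : ∀ i, LocalInvariant e (m + 1) ((Hermitian.step e m s).fPair i)
      ((Hermitian.step e m s).gPair i) (nextExponent e m s k i) i := fun i => by
    unfold nextExponent
    split_ifs with hc
    · exact h.step_regular hc
    · exact h.step_jump hc
  have hU : ∀ a b i, updatePoly e m s (partner m i) a b = updatePoly e m s i a b :=
    fun a b i => by rw [h.updatePoly_partner]
  have hfp := funext (fPair_step e m s)
  have hgp : (Hermitian.step e m s).gPair = fun i =>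
      updatePoly e m s i 1 0 • s.fPair (partner m i) + updatePoly e m s i 1 1 • s.gPair i :=
    funext fun i => by rw [gPair_step, h.updatePoly_partner]
  exact
    { lead := fun i => (hloc i).lead
      f_residual := fun i => (hloc i).f_residual
      φ_polar := fun i => (hloc i).φ_polar
      g_residual := fun i => (hloc i).g_residual
      g_residual_lead := fun i => (hloc i).g_residual_lead
      ψ_polar := fun i => (hloc i).ψ_polar
      g_coeff := fun i => (hloc i).g_coeff
      symplectic := by
        rw [hfp, hgp]
        exact h.symplectic.update (partner_partner m) (hU 0 0) (hU 0 1) (hU 1 0) (hU 1 1)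
          (det_updatePoly e m s)
      sum_det := by
        rw [hfp, hgp, ← h.sum_det]
        exact sum_det_update (partner_partner m) (hU 0 0) (hU 0 1) (hU 1 0) (hU 1 1)
          (det_updatePoly e m s) }

theorem exists_invariant (hK : Fintype.card K = q ^ 2) (e : Point K q → K) (m : ℕ) :
    ∃ k, Invariant e m (stateAt e m) k := by
  induction m with
  | zero => exact ⟨_, invariant_initial hK e⟩
  | succ m ih =>
    obtain ⟨k, hk⟩ := ih
    exact ⟨_, hk.step⟩

end Step

/-! ### Membership in the error locator ideal. -/

section Locator

variable {K : Type*} [Field K] {q : ℕ} {e : Point K q → K}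

theorem evalAt_algebraMap (P : Point K q) (u : K) :
    evalAt P (algebraMap K (CoordRing K q) u) = u := by
  rw [show algebraMap K (CoordRing K q) u = AdjoinRoot.of (curvePoly K q) (C u) from rfl, evalAt,
    AdjoinRoot.lift_of]
  simp

theorem smul_mem_errorLocatorIdeal {f : CoordRing K q} (u : K)
    (hf : f ∈ errorLocatorIdeal e) : u • f ∈ errorLocatorIdeal e := by
  rw [Algebra.smul_def]
  exact Ideal.mul_mem_left _ _ hf

theorem modEq_wt {k : ℕ} {i j : Fin q} {d : ℕ} (hd : (d : ℤ) = wt q k j) (h : d ≡ i [MOD q]) :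
    j = i := by
  have h1 := (Int.natCast_modEq_iff.2 h).dvd
  obtain ⟨n, hn⟩ := h1
  refine (wt_inj (q := q) (r := 0) (r' := -(k + n) - (i : ℕ)) ?_).2
  rw [hd] at hn
  unfold wt at hn ⊢
  linarith

/-- A function with value `1` in `P` and `0` in all other points. -/
theorem exists_evalAt_eq [Fintype K] [DecidableEq K] (P : Point K q) :
    ∃ h : CoordRing K q, evalAt P h = 1 ∧ ∀ Q, Q ≠ P → evalAt Q h = 0 := by
  have hc : Fintype.card K - 1 ≠ 0 := by have := Fintype.one_lt_card (α := K); omega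
  refine ⟨(1 - (x K q - algebraMap K _ P.1.1) ^ (Fintype.card K - 1)) *
    (1 - (y K q - algebraMap K _ P.1.2) ^ (Fintype.card K - 1)), ?_, fun Q hQ => ?_⟩
  · simp [evalAt_x, evalAt_y, evalAt_algebraMap, hc]
  · rw [map_mul, mul_eq_zero]
    simp only [map_sub, map_one, map_pow, evalAt_x, evalAt_y, evalAt_algebraMap]
    by_cases h1 : Q.1.1 = P.1.1
    · right
      rw [FiniteField.pow_card_sub_one_eq_one, sub_self]
      exact fun h2 => hQ (Subtype.ext (Prod.ext h1 (sub_eq_zero.1 h2)))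
    · left
      rw [FiniteField.pow_card_sub_one_eq_one _ (sub_ne_zero.2 h1), sub_self]

variable [Fact (IsPrimePow q)]

theorem exists_mem_hasLead (hK : Nat.card K = q ^ 2) (i : Fin q) :
    ∃ f ∈ errorLocatorIdeal e, ∃ k, HasLead f k i := by
  have hq := one_lt_q (q := q)
  have hfin : Finite K := Nat.finite_of_card_ne_zero (by rw [hK]; positivity)
  have := Fintype.ofFinite K
  -- The function (x^(q^2) - x) y^i vanishes at every rational point.
  refine ⟨x K q ^ (q ^ 2) * y K q ^ (i : ℕ) - x K q ^ 1 * y K q ^ (i : ℕ), fun P _ => ?_, 0 + q ^ 2,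
    ((hasLead_y_pow i).x_pow_mul _).sub fun a c h => ?_⟩
  · rw [map_sub, map_mul, map_mul, map_pow, map_pow, evalAt_x, ← hK, Nat.card_eq_fintype_card,
      FiniteField.pow_card, pow_one, evalAt_x, sub_self]
  · refine lt_of_le_of_lt (((hasLead_y_pow i).x_pow_mul 1).le a c h) ?_
    rw [wt_lt_iff]
    have : 1 < q ^ 2 := Nat.one_lt_pow two_ne_zero hq
    omega

/-- An element of the error locator ideal that attains `σ_i`. -/
theorem exists_mem_hasLead_sigma (hK : Nat.card K = q ^ 2) (e : Point K q → K) (i : Fin q) :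
    ∃ f ∈ errorLocatorIdeal e, ∃ k, HasLead f k i ∧ (sigma e i : ℤ) = wt q k i := by
  have hne : {d | d ≡ i [MOD q] ∧
      ∃ f ∈ errorLocatorIdeal e, f ≠ 0 ∧ rho f = d}.Nonempty := by
    obtain ⟨f, hf, k, hk⟩ := exists_mem_hasLead (e := e) hK i
    refine ⟨rho f, ?_, f, hf, hk.ne_zero, rfl⟩
    refine Int.natCast_modEq_iff.1 ?_
    rw [hk.rho_eq]
    refine (Int.modEq_of_dvd ⟨k + (i : ℕ), ?_⟩).symm
    unfold wt
    ring
  obtain ⟨hmod, f, hf, hf0, hr⟩ := Nat.sInf_mem hne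
  obtain ⟨u, k, j, -, hl, hrk⟩ := exists_hasLead hf0
  have hd : (sigma e i : ℤ) = wt q k j := by rw [← hrk, hr]; rfl
  have hji := modEq_wt hd hmod
  subst hji
  exact ⟨u • f, smul_mem_errorLocatorIdeal u hf, k, hl, hd⟩

/-- From σ_i on, every order in the class of i is attained in the ideal, by multiplying with powers
of x. So the footprint is bounded and its `sSup` is a true upper bound. -/
theorem footprint_lt_sigma (hK : Nat.card K = q ^ 2) {d : ℕ} (hd : d ∈ footprint e) :
    ∃ i, d < sigma e i := by
  obtain ⟨⟨f, hf, rfl⟩, hd⟩ := hd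
  obtain ⟨u, k, i, -, -, hr⟩ := exists_hasLead hf
  refine ⟨i, ?_⟩
  by_contra! hle
  obtain ⟨g, hg, n, hn, hs⟩ := exists_mem_hasLead_sigma hK e i
  have hnk : n ≤ k := by
    by_contra! hlt
    have : wt q k i < wt q n i := wt_lt_iff.2 (by exact_mod_cast hlt)
    omega
  have hl := hn.x_pow_mul (k - n)
  rw [Nat.add_sub_cancel' hnk] at hl
  refine hd ⟨_, Ideal.mul_mem_left _ _ hg, hl.ne_zero, ?_⟩
  have := hl.rho_eq
  omega

theorem le_sSup_footprint (hK : Nat.card K = q ^ 2) {d : ℕ} (hd : d ∈ footprint e) :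
    d ≤ sSup (footprint e) := by
  refine le_csSup ⟨(Finset.univ : Finset (Fin q)).sup (sigma e), fun d hd => ?_⟩ hd
  obtain ⟨i, hi⟩ := footprint_lt_sigma hK hd
  exact hi.le.trans (Finset.le_sup (Finset.mem_univ i))

variable [Fintype K] [DecidableEq K]

theorem syndromePart_eq_zero_of_mem {f : CoordRing K q} (hf : f ∈ errorLocatorIdeal e) {r : ℤ}
    (hr : 0 ≤ r) : syndromePart e r f = 0 := by
  rw [syndromePart_nonneg e hr]
  refine Finset.sum_eq_zero fun P _ => ?_
  by_cases h : e P = 0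
  · rw [h, zero_mul]
  · rw [hf P h, mul_zero, mul_zero]

variable {m : ℕ} {s : State K q} {k : Fin q → ℕ}

/-- If f in the ideal had lead x^n y^i with n < k_i, the residual of f · (g_i, ψ_i) at k_i - 1 - n
would be 1 by its leading term. But this index is nonnegative, so ψ_i does not contribute and the
syndrome part of an ideal element is 0. -/
theorem Invariant.wt_le_sigma (h : Invariant e m s k) (hK : Fintype.card K = q ^ 2)
    (i : Fin q) : wt q (k i) i ≤ sigma e i := by
  obtain ⟨f, hf, n, hn, hs⟩ :=
    exists_mem_hasLead_sigma (by rwa [Nat.card_eq_fintype_card]) e i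
  rw [hs]
  by_contra! hlt
  have hnk := wt_lt_iff.1 hlt
  have h1 := hn.residual_smul e (k i - 1 - n) (s.gPair i) fun a c hac => by
    refine h.g_residual i _ c ?_
    unfold wt at hac ⊢
    linarith
  rw [sub_add_cancel, h.g_residual_lead, residual_apply, polarPart_nonneg (by omega),
    Prod.smul_fst, smul_eq_mul,
    syndromePart_eq_zero_of_mem (Ideal.mul_mem_right _ _ hf) (by omega), sub_zero] at h1
  exact zero_ne_one h1

/-- The functional z ↦ ∑ e_P z(P) f_i(P) vanishes for all z, by induction on ρ(z). Up to max Δ the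
residual condition applies; beyond it, ρ(z) is the order of an ideal element, which is subtracted.
Taking z to be the indicator of P gives f_i(P) = 0. -/
theorem Invariant.f_mem (h : Invariant e m s k) (hK : Fintype.card K = q ^ 2) (i : Fin q)
    (hm : wt q (k i) i + sSup (footprint e) < m) : s.f i ∈ errorLocatorIdeal e := by
  have key : ∀ n (z : CoordRing K q), rho z = n → syndromePart e 0 (z * s.f i) = 0 := by
    intro n
    induction n using Nat.strong_induction_on with
    | _ n ih =>
      intro z hz
      by_cases hle : n ≤ sSup (footprint e)
      · have h1 : residual e 0 (z • s.fPair i) = 0 := by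
          rw [residual_smul]
          refine Finset.sum_eq_zero fun c _ => Finset.sum_eq_zero fun a ha => ?_
          beta_reduce
          have := le_rho (mem_support_iff.1 ha)
          rw [h.f_residual, mul_zero]
          rw [zero_add]
          omega
        rwa [residual_apply, polarPart_nonneg le_rfl, sub_zero] at h1
      · by_cases hz0 : z = 0
        · rw [hz0, zero_mul, map_zero]
        obtain ⟨u, a, c, hu, hl, hr⟩ := exists_hasLead hz0
        have hnot : n ∉ footprint e :=
          fun hn => hle (le_sSup_footprint (by rwa [Nat.card_eq_fintype_card]) hn)
        have hex : ∃ f ∈ errorLocatorIdeal e, f ≠ 0 ∧ rho f = n := by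
          by_contra hno
          exact hnot ⟨⟨z, hz0, hz⟩, hno⟩
        obtain ⟨f, hf, hf0, hfr⟩ := hex
        obtain ⟨u', a', c', -, hl', hr'⟩ := exists_hasLead hf0
        obtain ⟨ha, rfl⟩ := wt_inj (show wt q a' c' = wt q a c by rw [← hr, ← hr', hz, hfr])
        obtain rfl : a' = a := by exact_mod_cast ha
        have h1 : syndromePart e 0 ((u • z - u' • f) * s.f i) = 0 := by
          by_cases hd : u • z - u' • f = 0
          · rw [hd, zero_mul, map_zero]
          · refine ih _ ?_ _ rfl
            have h2 := rho_sub_lt hl hl' hd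
            have h3 := hl.rho_eq
            omega
        rw [sub_mul, map_sub, syndromePart_eq_zero_of_mem (Ideal.mul_mem_right _ _
          (smul_mem_errorLocatorIdeal u' hf)) le_rfl, sub_zero, smul_mul_assoc, map_smul,
          smul_eq_mul] at h1
        exact (mul_eq_zero.1 h1).resolve_left hu
  intro P hP
  obtain ⟨z, hz1, hz0⟩ := exists_evalAt_eq P
  have h1 := key _ z rfl
  rw [syndromePart_nonneg e le_rfl, Finset.sum_eq_single P] at h1
  · rw [map_mul, hz1] at h1
    simpa [hP] using h1
  · intro Q _ hQ
    rw [map_mul, hz0 Q hQ]; simp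
  · intro hP'
    exact absurd (Finset.mem_univ P) hP'

end Locator

/-! ### Values of φ at error positions. -/

section Evaluation

variable {K : Type*} [Field K] {q : ℕ} [Fact (IsPrimePow q)]

/-- `∑ β ^ c z_c^∗` for a point `P = (α, β)`. -/
def pointStar (P : Point K q) : CoordRing K q :=
  ∑ c : Fin q, (C (P.1.2 ^ (c : ℕ)) : K[X]) • zstar K q c

theorem trace_mul_pointStar (P : Point K q) (f : CoordRing K q) :
    trace (f * pointStar P) = ∑ c : Fin q, C (P.1.2 ^ (c : ℕ)) * component f c := by
  rw [pointStar, Finset.mul_sum, map_sum]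
  refine Finset.sum_congr rfl fun c _ => ?_
  rw [mul_smul_comm, map_smul, trace_mul_zstar, smul_eq_mul]

theorem evalAt_pointStar (P Q : Point K q) :
    evalAt Q (pointStar P) = ∑ c ∈ Finset.range q, P.1.2 ^ c * Q.1.2 ^ (q - 1 - c) + 1 := by
  rw [← sum_mul_zstar (fun c => evalAt Q (zstar K q c)), pointStar, map_sum]
  · refine Finset.sum_congr rfl fun c _ => ?_
    rw [evalAt_smul, eval_C]
  · intro c
    rw [zstar]
    split_ifs <;> simp [evalAt_y]

/-- Multiplied by β_P - β_Q, the value becomes the difference of the curve equations at P and Q,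
which share the right-hand α. -/
theorem evalAt_pointStar_of_ne {P Q : Point K q} (h1 : P.1.1 = Q.1.1) (hne : P ≠ Q) :
    evalAt Q (pointStar P) = 0 := by
  have h2 : P.1.2 - Q.1.2 ≠ 0 := fun h => hne (Subtype.ext (Prod.ext h1 (sub_eq_zero.1 h)))
  refine (mul_eq_zero.1 (?_ : _ * (P.1.2 - Q.1.2) = 0)).resolve_right h2
  rw [evalAt_pointStar, add_mul, geom_sum₂_mul]
  have hP := P.2
  have hQ := Q.2
  rw [h1] at hP
  linear_combination hQ - hP

theorem pointPart_mul (P : Point K q) (r : ℤ) (f : CoordRing K q) :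
    pointPart P r ((X - C P.1.1 : K[X]) • f) = polarPart r (f * pointStar P) := by
  rw [polarPart_apply, trace_mul_pointStar, map_sum, pointPart]
  refine Finset.sum_congr rfl fun c _ => ?_
  rw [component_smul, seqPair_geom, ← smul_eq_C_mul, map_smul, smul_eq_mul]

variable [Fintype K]

theorem exists_cofactor (α : K) :
    ∃ p : K[X], (X - C α) * p = X ^ Fintype.card K - X :=
  (dvd_iff_isRoot.2 (by simp [FiniteField.pow_card])).imp fun _ h => h.symm

theorem evalAt_pointStar_self (hK : Fintype.card K = q ^ 2) (P : Point K q) :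
    evalAt P (pointStar P) = 1 := by
  have h1 : ∀ c ∈ Finset.range q, P.1.2 ^ c * P.1.2 ^ (q - 1 - c) = P.1.2 ^ (q - 1) :=
    fun c hc => by
      rw [← pow_add]; congr 1; have := Finset.mem_range.1 hc; omega
  rw [evalAt_pointStar, Finset.sum_congr rfl h1, Finset.sum_const, Finset.card_range,
    nsmul_eq_mul, natCast_q_eq_zero hK, zero_mul, zero_add]

variable [DecidableEq K]

/-- For `f` in the error locator ideal with `f S = φ`, where `S` is the syndrome series, the
values of `φ` are those of `f'` times the errors. -/
theorem evalAt_eq_mul_ddx (hK : Fintype.card K = q ^ 2) {e : Point K q → K}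
    {f φ : CoordRing K q} (hf : f ∈ errorLocatorIdeal e)
    (h : ∀ r (c : Fin q), residual e r (y K q ^ (c : ℕ) • (f, φ)) = 0)
    (Q : Point K q) (hQ : e Q ≠ 0) : evalAt Q φ = e Q * evalAt Q (ddx hK f) := by
  choose p hp using exists_cofactor (K := K)
  set G : K[X] := X ^ Fintype.card K - X with hG
  -- N is G S with denominators cleared, where `p α` is G / (x - α).
  set N : CoordRing K q := ∑ P, (C (e P) * p P.1.1) • pointStar P with hN
  have hGφ : G • φ = f * N := by
    refine eq_of_polarPart fun r c => ?_
    have h1 : residual e r (G • (y K q ^ (c : ℕ)) • (f, φ)) = 0 := by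
      rw [← smul_assoc, residual_polynomial_smul]
      refine Finset.sum_eq_zero fun a _ => ?_
      beta_reduce
      rw [h, mul_zero]
    rw [residual_apply, sub_eq_zero] at h1
    simp only [Prod.smul_fst, Prod.smul_snd, smul_eq_mul] at h1
    rw [mul_smul_comm, ← h1, syndromePart_eq_sum, hN, Finset.mul_sum, Finset.mul_sum, map_sum]
    refine Finset.sum_congr rfl fun P _ => ?_
    rw [← hp P.1.1, mul_smul, pointPart_mul, mul_smul, ← smul_eq_C_smul, mul_smul_comm,
      mul_smul_comm, map_smul, smul_eq_mul, mul_smul_comm, mul_smul_comm, smul_mul_assoc,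
      mul_assoc]
  have hGx : G • φ = (x K q ^ (q ^ 2) - x K q) * φ := by
    rw [hG, sub_smul, ← x_pow_mul, ← x_mul, hK, sub_mul]
  have hpe : ∀ P : Point K q, (p P.1.1).eval Q.1.1 = if P.1.1 = Q.1.1 then -1 else 0 := by
    intro P
    split_ifs with hPQ
    -- Differentiating (x - α) p = G at α gives p(α) = G'(α) = -1.
    · have := congrArg (fun g => eval Q.1.1 (derivative g)) (hp P.1.1)
      simpa [hG, hPQ, derivative_X_pow] using this
    · have := congrArg (eval Q.1.1) (hp P.1.1)
      rw [hG] at this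
      simp only [eval_mul, eval_sub, eval_X, eval_C, eval_pow, FiniteField.pow_card, sub_self,
        mul_eq_zero] at this
      exact this.resolve_left fun h0 => hPQ (sub_eq_zero.1 h0).symm
  -- Points with a different α are killed by the cofactor, points with the same α by `pointStar`.
  have hNQ : evalAt Q N = -e Q := by
    rw [hN, map_sum, Finset.sum_eq_single Q]
    · rw [evalAt_smul, eval_mul, eval_C, hpe, if_pos rfl, evalAt_pointStar_self hK]; ring
    · intro P _ hPQ
      rw [evalAt_smul, eval_mul, hpe]
      split_ifs with h1
      · rw [evalAt_pointStar_of_ne h1 hPQ, mul_zero]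
      · rw [mul_zero, zero_mul]
    · intro h0
      exact absurd (Finset.mem_univ Q) h0
  have hD := congrArg (fun g => evalAt Q (ddx hK g)) (hGx.symm.trans hGφ)
  have hq2 : ddx hK (x K q ^ (q ^ 2)) = 0 := by
    rw [Derivation.leibniz_pow, ddx_x, ← Nat.cast_smul_eq_nsmul K, Nat.cast_pow,
      natCast_q_eq_zero hK]
    simp
  have hx : Q.1.1 ^ q ^ 2 = Q.1.1 := by rw [← hK, FiniteField.pow_card]
  simp only [Derivation.leibniz, map_sub, hq2, ddx_x, smul_eq_mul, map_add, map_mul, map_pow,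
    evalAt_x, hx, hNQ, hf Q hQ, map_zero, map_one] at hD
  linear_combination -hD

end Evaluation

/-! ### Termination and the error formula. -/

section Main

variable {K : Type*} [Field K] {q : ℕ} [Fact (IsPrimePow q)] [Fintype K] [DecidableEq K]

theorem exists_invariant_finalState (hK : Fintype.card K = q ^ 2) (e : Point K q → K) :
    ∃ m k, Invariant e m (finalState e) k ∧ ∀ i, wt q (k i) i + sSup (footprint e) < m ∧
      wt q (k i) i + wt q (-1) (q - 1 : ℕ) < m := by
  obtain ⟨k, hk⟩ := exists_invariant hK e (lastIteration e + 1)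
  refine ⟨_, k, hk, fun i => ?_⟩
  have h1 := hk.wt_le_sigma hK i
  have h2 : sigma e i ≤ (Finset.univ : Finset (Fin q)).sup (sigma e) :=
    Finset.le_sup (Finset.mem_univ i)
  have hq := one_lt_q (q := q)
  -- Among monomials with negative exponent of x, x^(-1) y^(q-1) has the largest order. This is the
  -- origin of q^2 - q - 1 in M.
  have h3 : wt q (-1) (q - 1 : ℕ) = (q ^ 2 - q - 1 : ℕ) := by
    unfold wt
    have : q + 1 ≤ q ^ 2 := by nlinarith
    rw [Nat.sub_sub]
    push_cast [Nat.cast_sub hq.le, Nat.cast_sub this]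
    ring
  rw [h3]
  unfold lastIteration
  omega

/-- Residuals with r ≥ 0 vanish by membership in the ideal, those with r < 0 because their order is
at most q^2 - q - 1. -/
theorem residual_finalState (hK : Fintype.card K = q ^ 2) (e : Point K q → K) (i : Fin q) :
    (finalState e).f i ∈ errorLocatorIdeal e ∧ ∀ r (c : Fin q),
      residual e r (y K q ^ (c : ℕ) • ((finalState e).f i, (finalState e).φ i)) = 0 := by
  obtain ⟨m, k, hk, hm⟩ := exists_invariant_finalState hK e
  have hf := hk.f_mem hK i (hm i).1
  refine ⟨hf, fun r c => ?_⟩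
  by_cases hr : 0 ≤ r
  · rw [residual_apply, polarPart_nonneg hr, sub_zero]
    exact syndromePart_eq_zero_of_mem (Ideal.mul_mem_left _ _ hf) hr
  · refine hk.f_residual i r c ?_
    have h1 := (hm i).2
    have h2 : wt q r c ≤ wt q (-1) (q - 1 : ℕ) := by
      have hc : ((c : ℕ) : ℤ) ≤ (q - 1 : ℕ) := by have := c.2; omega
      unfold wt
      gcongr
      omega
    linarith

theorem sum_mul_error (hK : Fintype.card K = q ^ 2) (e : Point K q → K) (P : Point K q)
    (hP : e P ≠ 0) :
    (∑ i, evalAt P (ddx hK ((finalState e).f i)) * evalAt P ((finalState e).g i)) * e P = 1 := by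
  obtain ⟨m, k, hk, -⟩ := exists_invariant_finalState hK e
  have h := congrArg (evalAt P) hk.sum_det
  simp only [State.fPair, State.gPair, map_sum, map_sub, map_mul, map_neg, map_one] at h
  rw [Finset.sum_mul, ← neg_inj, ← h, ← Finset.sum_neg_distrib]
  refine Finset.sum_congr rfl fun i _ => ?_
  obtain ⟨hf, hres⟩ := residual_finalState hK e i
  rw [hf P hP, evalAt_eq_mul_ddx hK hf hres P hP]
  ring

end Main

end

end Hermitian

theorem mainTheorem4 (q : ℕ) [Fact (IsPrimePow q)] (K : Type*) [Field K] [Fintype K]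
    [DecidableEq K] (hK : Fintype.card K = q ^ 2) (e : Hermitian.Point K q → K)
    (P : Hermitian.Point K q) (hP : e P ≠ 0) :
    e P = (∑ i : Fin q,
      Hermitian.evalAt P (Hermitian.ddx hK ((Hermitian.finalState e).f i)) *
        Hermitian.evalAt P ((Hermitian.finalState e).g i))⁻¹ :=
  eq_inv_of_mul_eq_one_right (Hermitian.sum_mul_error hK e P hP)
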